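/- **Fundamental theorem of forcing.** Let $\mathbb B$ be a complete Boolean algebra in a type universe $\mathrm{Type}\,u$. Let $\mathrm{bSet}\,\mathbb B$ be the inductive type of $\mathbb B$-names, whose elements are the triples $\langle \alpha, A, B\rangle$ with $\alpha:\mathrm{Type}\,u$, $A:\alpha\to \mathrm{bSet}\,\mathbb B$ and $B:\alpha\to\mathbb B$. Define $\mathbb B$-valued equality and membership recursively: for $x=\langle\alpha,A,B\rangle$ and $y=\langle\alpha',A',B'\rangle$, $$[\![x=y]\!]=\bigwedge_{a:\alpha}\Big(B(a)\Rightarrow\bigvee_{a':\alpha'}B'(a')\wedge[\![A(a)=A'(a')]\!]\Big)\wedge\bigwedge_{a':\alpha'}\Big(B'(a')\Rightarrow\bigvee_{a:\alpha}B(a)\wedge[\![A(a)=A'(a')]\!]\Big),$$ $$[\![z\in y]\!]=\bigvee_{a':\alpha'}B'(a')\wedge[\![z=A'(a')]\!].$$ Extend $[\![\cdot]\!]$ to all first-order formulas of the language $\{\in\}$ with parameters in $\mathrm{bSet}\,\mathbb B$, interpreting falsum as $\bot$, implication as $\Rightarrow$ and $\forall$ as the infimum over $\mathrm{bSet}\,\mathbb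 B$ (the other connectives and $\exists$ being defined classically from these). Then $\mathrm{bSet}\,\mathbb B$ is a Boolean-valued model of $\mathsf{ZFC}$, that is: 1. It is a $\mathbb B$-valued structure: $[\![x=x]\!]=\top$, $[\![x=y]\!]=[\![y=x]\!]$, $[\![x=y]\!]\wedge[\![y=z]\!]\le[\![x=z]\!]$, and $[\![x=x']\!]\wedge[\![y=y']\!]\wedge[\![x\in y]\!]\le[\![x'\in y']\!]$. 2. $[\![\sigma]\!]=\top$ for every axiom $\sigma$ of $\mathsf{ZFC}$: extensionality, empty set, pairing, union, power set, infinity, regularity, all instances with parameters of the separation, replacement and collection schemas, and the axiom of choice (for every set of nonempty pairwise disjoint sets there is a set meeting each of them in exactly one element). Moreover: 3. $[\![\text{Zorn's lemma}]\!]=\top$, where Zorn's lemma is the sentence "every partially ordered set in which each chain (including the empty one) has an upper bound has a maximal element". 4. (Mixtures.) For every $\iota:\mathrm{Type}\,u$ and all families $(a_i)_{i:\iota}$ in $\mathbb B$ and $(\tau_i)_{i:\iota}$ in $\mathrm{bSet}\,\mathbb B$ with $a_i\wedge a_j\le[\![\tau_i=\tau_j]\!]$ for all $i,j$, there is $x:\mathrm{bSet}\,\mathbb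 B$ with $a_i\le[\![x=\tau_i]\!]$ for all $i$. 5. (Maximum principle.) For every formula $\varphi(p_0,\dots,p_{n-1},x)$ of the language $\{\in\}$ and all $p_0,\dots,p_{n-1}:\mathrm{bSet}\,\mathbb B$ there is $x:\mathrm{bSet}\,\mathbb B$ with $[\![\varphi(p,x)]\!]=[\![\exists x\,\varphi(p,x)]\!]$. -/

import Mathlib

open FirstOrder FirstOrder.Language

universe u v w u' v'

namespace BooleanValued

/-! ### Boolean-valued first-order structures -/

/-- The data of a `𝔹`-valued interpretation of the language `L` on the carrier `M`: operations for
the function symbols, `𝔹`-valued relations for the relation symbols, and a `𝔹`-valued equality. -/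
structure Interpretation (L : FirstOrder.Language.{u', v'}) (𝔹 : Type u) (M : Type w) where
  funMap : ∀ {n : ℕ}, L.Functions n → (Fin n → M) → M
  relMap : ∀ {n : ℕ}, L.Relations n → (Fin n → M) → 𝔹
  eq : M → M → 𝔹

namespace Interpretation

variable {L : FirstOrder.Language.{u', v'}} {𝔹 : Type u} [CompleteBooleanAlgebra 𝔹] {M : Type w}

/-- The laws of a `𝔹`-valued structure: `𝔹`-valued equality is reflexive, symmetric and transitive,
and all function and relation symbols respect it. -/
structure IsStructure (S : Interpretation L 𝔹 M) : Prop where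
  eq_refl : ∀ x, S.eq x x = ⊤
  eq_symm : ∀ x y, S.eq x y = S.eq y x
  eq_trans : ∀ x y z, S.eq x y ⊓ S.eq y z ≤ S.eq x z
  fun_congr : ∀ {n : ℕ} (f : L.Functions n) (x y : Fin n → M),
    (⨅ i, S.eq (x i) (y i)) ≤ S.eq (S.funMap f x) (S.funMap f y)
  rel_congr : ∀ {n : ℕ} (R : L.Relations n) (x y : Fin n → M),
    (⨅ i, S.eq (x i) (y i)) ⊓ S.relMap R x ≤ S.relMap R y

/-- The value in `M` of a term under an assignment of its variables. -/
def termValue (S : Interpretation L 𝔹 M) {α : Type v} (s : α → M) : L.Term α → M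
  | .var k => s k
  | .func f ts => S.funMap f fun i => termValue S s (ts i)

/-- The truth value in `𝔹` of a formula, with free variables in `α` assigned by `s` and with the
de Bruijn levels `0, …, n - 1` assigned by `xs`. -/
def value (S : Interpretation L 𝔹 M) {α : Type v} (s : α → M) :
    ∀ {n : ℕ}, L.BoundedFormula α n → (Fin n → M) → 𝔹
  | _, .falsum, _ => ⊥
  | _, .equal t₁ t₂, xs => S.eq (S.termValue (Sum.elim s xs) t₁) (S.termValue (Sum.elim s xs) t₂)
  | _, .rel R ts, xs => S.relMap R fun i => S.termValue (Sum.elim s xs) (ts i)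
  | _, .imp φ ψ, xs => value S s φ xs ⇨ value S s ψ xs
  | _, .all φ, xs => ⨅ x : M, value S s φ (Fin.snoc xs x)

/-- The truth value of a sentence. -/
def truth (S : Interpretation L 𝔹 M) (φ : L.Sentence) : 𝔹 :=
  S.value Empty.elim φ Fin.elim0

/-- `S` is a `𝔹`-valued model of the theory `T`: it is a `𝔹`-valued structure in which every
sentence of `T` has truth value `⊤`. -/
def IsModel (S : Interpretation L 𝔹 M) (T : L.Theory) : Prop :=
  S.IsStructure ∧ ∀ φ ∈ T, S.truth φ = ⊤

end Interpretation

/-! ### The language of set theory and the axioms of ZFC -/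

/-- The only symbol of the language of set theory. -/
inductive SetRel : ℕ → Type
  | mem : SetRel 2

/-- The language of set theory: a single binary relation symbol. -/
def setLanguage : FirstOrder.Language.{0, 0} := ⟨fun _ => Empty, SetRel⟩

/-- Formulas of set theory in the variables `0, …, n - 1`. Variables are de Bruijn levels: in such a
formula the next quantifier binds the variable `n`. -/
abbrev SetFormula (n : ℕ) : Type := setLanguage.BoundedFormula Empty n

/-- The atomic formula `i ∈ j`. -/
def memF {n : ℕ} (i j : Fin n) : SetFormula n :=
  Relations.boundedFormula₂ (L := setLanguage) SetRel.mem (&i) (&j)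

/-- The atomic formula `i = j`. -/
def eqF {n : ℕ} (i j : Fin n) : SetFormula n :=
  Term.bdEqual (L := setLanguage) (&i) (&j)

/-- `i ⊆ j`. -/
def subsetF {n : ℕ} (i j : Fin n) : SetFormula n :=
  ∀' (memF (Fin.last n) i.castSucc ⟹ memF (Fin.last n) j.castSucc)

/-- `w = {i, j}`. -/
def isPairF {n : ℕ} (w i j : Fin n) : SetFormula n :=
  ∀' (memF (Fin.last n) w.castSucc ⇔ (eqF (Fin.last n) i.castSucc ⊔ eqF (Fin.last n) j.castSucc))

/-- `p` is the ordered pair `(i, j) = {{i}, {i, j}}`. -/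
def isOrderedPairF {n : ℕ} (p i j : Fin n) : SetFormula n :=
  ∀' (memF (Fin.last n) p.castSucc ⇔
    (isPairF (Fin.last n) i.castSucc i.castSucc ⊔ isPairF (Fin.last n) i.castSucc j.castSucc))

/-- `(i, j) ∈ r`. -/
def relatedF {n : ℕ} (r i j : Fin n) : SetFormula n :=
  ∃' (isOrderedPairF (Fin.last n) i.castSucc j.castSucc ⊓ memF (Fin.last n) r.castSucc)

/-- The formula `φ` with each free variable `k` replaced by the variable `σ k`. -/
def place {α : Type} {m : ℕ} (φ : setLanguage.Formula α) (σ : α → Fin m) : SetFormula m :=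
  BoundedFormula.relabel (n := m) (k := 0) (fun k => Sum.inr (σ k)) φ

/-- Two sets with the same elements are equal. -/
def extensionality : setLanguage.Sentence :=
  ∀' ∀' ((∀' (memF (n := 3) 2 0 ⇔ memF 2 1)) ⟹ eqF 0 1)

/-- There is a set without elements. -/
def emptySet : setLanguage.Sentence :=
  ∃' ∀' ∼(memF (n := 2) 1 0)

/-- `{x, y}` exists for all `x`, `y`. -/
def pairing : setLanguage.Sentence :=
  ∀' ∀' ∃' (isPairF (n := 3) 2 0 1)

/-- `⋃ x` exists for every `x`. -/
def union : setLanguage.Sentence :=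
  ∀' ∃' ∀' (memF (n := 3) 2 1 ⇔ ∃' (memF (n := 4) 3 0 ⊓ memF 2 3))

/-- The set of all subsets of `x` exists for every `x`. -/
def powerSet : setLanguage.Sentence :=
  ∀' ∃' ∀' (memF (n := 3) 2 1 ⇔ subsetF 2 0)

/-- Some set contains the empty set and is closed under `x ↦ x ∪ {x}`. -/
def infinity : setLanguage.Sentence :=
  ∃' ((∃' (memF (n := 2) 1 0 ⊓ ∀' ∼(memF (n := 3) 2 1))) ⊓
    ∀' (memF (n := 2) 1 0 ⟹
      ∃' (memF (n := 3) 2 0 ⊓ ∀' (memF (n := 4) 3 2 ⇔ (memF 3 1 ⊔ eqF 3 1)))))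

/-- Every nonempty set has an element disjoint from it. -/
def regularity : setLanguage.Sentence :=
  ∀' ((∃' (memF (n := 2) 1 0)) ⟹
    ∃' (memF (n := 2) 1 0 ⊓ ∼(∃' (memF (n := 3) 2 1 ⊓ memF 2 0))))

/-- Separation for `φ(p₀, …, pₙ₋₁, x)`: for all `p` and `a`, the set `{x ∈ a | φ(p, x)}` exists. -/
def separation (n : ℕ) (φ : setLanguage.Formula (Fin n ⊕ Fin 1)) : setLanguage.Sentence :=
  BoundedFormula.alls (n := n) <| ∀' ∃' ∀' (
    memF (n := n + 3) (Fin.natAdd n 2) (Fin.natAdd n 1) ⇔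
      (memF (n := n + 3) (Fin.natAdd n 2) (Fin.natAdd n 0) ⊓
        place (m := n + 3) φ (Sum.elim (Fin.castAdd 3) ![Fin.natAdd n 2])))

/-- Replacement for `φ(p₀, …, pₙ₋₁, x, y)`: for all `p` and `a`, if for each `x ∈ a` there is at most
one `y` with `φ(p, x, y)`, then the set `{y | ∃ x ∈ a, φ(p, x, y)}` exists. -/
def replacement (n : ℕ) (φ : setLanguage.Formula (Fin n ⊕ Fin 2)) : setLanguage.Sentence :=
  let ψ : Fin 4 → Fin 4 → SetFormula (n + 4) := fun x y =>
    place φ (Sum.elim (Fin.castAdd 4) ![Fin.natAdd n x, Fin.natAdd n y])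
  BoundedFormula.alls (n := n) <| ∀' (
    (∀' (memF (n := n + 2) (Fin.natAdd n 1) (Fin.natAdd n 0) ⟹
      ∀' ∀' ((ψ 1 2 ⊓ ψ 1 3) ⟹ eqF (n := n + 4) (Fin.natAdd n 2) (Fin.natAdd n 3)))) ⟹
    ∃' ∀' (memF (n := n + 3) (Fin.natAdd n 2) (Fin.natAdd n 1) ⇔
      ∃' (memF (n := n + 4) (Fin.natAdd n 3) (Fin.natAdd n 0) ⊓ ψ 3 2)))

/-- Collection for `φ(p₀, …, pₙ₋₁, x, y)`: for all `p` and `a`, if for each `x ∈ a` there is some `y`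
with `φ(p, x, y)`, then some set `b` contains such a `y` for each `x ∈ a`. -/
def collection (n : ℕ) (φ : setLanguage.Formula (Fin n ⊕ Fin 2)) : setLanguage.Sentence :=
  BoundedFormula.alls (n := n) <| ∀' (
    (∀' (memF (n := n + 2) (Fin.natAdd n 1) (Fin.natAdd n 0) ⟹
      ∃' (place (m := n + 3) φ (Sum.elim (Fin.castAdd 3) ![Fin.natAdd n 1, Fin.natAdd n 2])))) ⟹
    ∃' ∀' (memF (n := n + 3) (Fin.natAdd n 2) (Fin.natAdd n 0) ⟹
      ∃' (memF (n := n + 4) (Fin.natAdd n 3) (Fin.natAdd n 1) ⊓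
        place (m := n + 4) φ (Sum.elim (Fin.castAdd 4) ![Fin.natAdd n 2, Fin.natAdd n 3]))))

/-- Axiom of choice: for every set of nonempty, pairwise disjoint sets there is a set that has
exactly one element in common with each of them. -/
def choice : setLanguage.Sentence :=
  ∀' (((∀' (memF (n := 2) 1 0 ⟹ ∃' (memF (n := 3) 2 1))) ⊓
      (∀' ∀' ((memF (n := 3) 1 0 ⊓ memF 2 0) ⟹
        ((∃' (memF (n := 4) 3 1 ⊓ memF 3 2)) ⟹ eqF 1 2)))) ⟹
    ∃' ∀' (memF (n := 3) 2 0 ⟹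
      ∃' ((memF (n := 4) 3 1 ⊓ memF 3 2) ⊓
        ∀' ((memF (n := 5) 4 1 ⊓ memF 4 2) ⟹ eqF 4 3))))

/-- The variable `1` is (the graph of) a relation that is a partial order on the set `0`. -/
def isPartialOrderF : SetFormula 2 :=
  (∀' (memF (n := 3) 2 0 ⟹ relatedF 1 2 2)) ⊓
  ((∀' ∀' ((memF (n := 4) 2 0 ⊓ memF 3 0) ⟹
      ((relatedF 1 2 3 ⊓ relatedF 1 3 2) ⟹ eqF 2 3))) ⊓
    (∀' ∀' ∀' ((memF (n := 5) 2 0 ⊓ (memF 3 0 ⊓ memF 4 0)) ⟹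
      ((relatedF 1 2 3 ⊓ relatedF 1 3 4) ⟹ relatedF 1 2 4))))

/-- Zorn's lemma: if `1` is a partial order on `0`, and every subset `2` of `0` which is a chain has
an upper bound in `0`, then `0` has a maximal element. -/
def zorn : setLanguage.Sentence :=
  ∀' ∀' ((isPartialOrderF ⊓
      ∀' ((subsetF (n := 3) 2 0 ⊓
          ∀' ∀' ((memF (n := 5) 3 2 ⊓ memF 4 2) ⟹ (relatedF 1 3 4 ⊔ relatedF 1 4 3))) ⟹
        ∃' (memF (n := 4) 3 0 ⊓ ∀' (memF (n := 5) 4 2 ⟹ relatedF 1 4 3)))) ⟹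
    ∃' (memF (n := 3) 2 0 ⊓ ∀' (memF (n := 4) 3 0 ⟹ (relatedF 1 2 3 ⟹ eqF 3 2))))

/-- The theory ZFC, with both the replacement and the collection schema. -/
def ZFC : setLanguage.Theory :=
  {extensionality, emptySet, pairing, union, powerSet, infinity, regularity, choice} ∪
    {σ | ∃ n φ, σ = separation n φ} ∪ {σ | ∃ n φ, σ = replacement n φ} ∪
    {σ | ∃ n φ, σ = collection n φ}

/-! ### The universe of `𝔹`-names -/

/-- The type of `𝔹`-names. -/
inductive bSet (𝔹 : Type u) : Type (u + 1)
  | mk (α : Type u) (A : α → bSet 𝔹) (B : α → 𝔹) : bSet 𝔹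

namespace bSet

variable {𝔹 : Type u} [CompleteBooleanAlgebra 𝔹]

/-- Boolean-valued equality of names. -/
def bvEq : bSet 𝔹 → bSet 𝔹 → 𝔹
  | ⟨α, A, B⟩, ⟨α', A', B'⟩ =>
    (⨅ a : α, B a ⇨ ⨆ a' : α', B' a' ⊓ bvEq (A a) (A' a')) ⊓
      (⨅ a' : α', B' a' ⇨ ⨆ a : α, B a ⊓ bvEq (A a) (A' a'))

/-- Boolean-valued membership of names. -/
def bvMem : bSet 𝔹 → bSet 𝔹 → 𝔹
  | x, ⟨α', A', B'⟩ => ⨆ a' : α', B' a' ⊓ bvEq x (A' a')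

variable (𝔹) in
/-- The `𝔹`-valued interpretation of the language of set theory on the `𝔹`-names. -/
def interpretation : Interpretation setLanguage 𝔹 (bSet 𝔹) where
  funMap := fun f _ => Empty.elim f
  relMap := fun R =>
    match R with
    | SetRel.mem => fun xs => bvMem (xs 0) (xs 1)
  eq := bvEq

end bSet

end BooleanValued

namespace BooleanValued

/-! ### Truth values of the connectives, and congruence -/

namespace Interpretation

variable {L : FirstOrder.Language.{u', v'}} {𝔹 : Type u} [CompleteBooleanAlgebra 𝔹] {M : Type w}
  {α : Type v} {n : ℕ}

/-! Truth values are studied through two-valued quotients. A homomorphism `p` from `𝔹` to `Prop` is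
an ultrafilter; names modulo `p (bvEq x y)` form an ordinary structure `Germ p` for set theory. By
the prime ideal theorem such points separate the elements of `𝔹`, so a truth value is `⊤` once the
sentence holds in every `Germ p`.

A point preserves finite meets and joins but not arbitrary ones. The remedy is the maximum
principle: a supremum over names of a predicate respecting equality is attained at a name, obtained
by mixing names along an antichain. Hence points do commute with quantifiers over names, which gives
Łoś's theorem `realize_iff_value`. For most axioms what remains is to build names whose membership
values are the expected ones.

Suprema over the index type of a single name are still not preserved by a point, so arguments that
pick an index are carried out as inequalities in `𝔹`. Choice and Zorn's lemma therefore use their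
hypothesis not at one point but at every point containing its truth value `h`
(`realize_imp_of_forall`). Choice then follows from a well-order of the indices of a name, and
Zorn's lemma from Zorn's lemma for the names that lie in the given set with value at least `h`. -/

theorem value_all (S : Interpretation L 𝔹 M) (s : α → M) (φ : L.BoundedFormula α (n + 1))
    (xs : Fin n → M) : S.value s φ.all xs = ⨅ x, S.value s φ (Fin.snoc xs x) :=
  rfl

theorem value_imp (S : Interpretation L 𝔹 M) (s : α → M) (φ ψ : L.BoundedFormula α n)
    (xs : Fin n → M) : S.value s (φ.imp ψ) xs = S.value s φ xs ⇨ S.value s ψ xs :=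
  rfl

theorem value_ex (S : Interpretation L 𝔹 M) (s : α → M) (φ : L.BoundedFormula α (n + 1))
    (xs : Fin n → M) : S.value s φ.ex xs = ⨆ x, S.value s φ (Fin.snoc xs x) := by
  change ((⨅ x, S.value s φ (Fin.snoc xs x) ⇨ ⊥) ⇨ ⊥) = _
  simp only [himp_bot, compl_iInf, compl_compl]

theorem IsStructure.termValue_congr {S : Interpretation L 𝔹 M} (hS : S.IsStructure) {Γ : 𝔹}
    {s t : α → M} (h : ∀ i, Γ ≤ S.eq (s i) (t i)) (τ : L.Term α) :
    Γ ≤ S.eq (S.termValue s τ) (S.termValue t τ) := by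
  induction τ with
  | var k => exact h k
  | func f ts ih => exact (le_iInf ih).trans (hS.fun_congr f _ _)

theorem IsStructure.value_congr {S : Interpretation L 𝔹 M} (hS : S.IsStructure) {Γ : 𝔹}
    {s t : α → M} (h : ∀ i, Γ ≤ S.eq (s i) (t i)) (φ : L.BoundedFormula α n) {xs ys : Fin n → M}
    (hxy : ∀ i, Γ ≤ S.eq (xs i) (ys i)) : Γ ⊓ S.value s φ xs ≤ S.value t φ ys := by
  induction φ generalizing s t with
  | falsum => exact inf_le_right
  | equal t₁ t₂ =>
    have hst : ∀ i, Γ ≤ S.eq (Sum.elim s xs i) (Sum.elim t ys i) := by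
      rintro (i | i)
      exacts [h i, hxy i]
    have h₁ := hS.termValue_congr hst t₁
    rw [hS.eq_symm] at h₁
    exact (le_inf ((le_inf (inf_le_left.trans h₁) inf_le_right).trans (hS.eq_trans _ _ _))
      (inf_le_left.trans (hS.termValue_congr hst t₂))).trans (hS.eq_trans _ _ _)
  | rel R ts =>
    have hst : ∀ i, Γ ≤ S.eq (Sum.elim s xs i) (Sum.elim t ys i) := by
      rintro (i | i)
      exacts [h i, hxy i]
    exact (inf_le_inf_right _ (le_iInf fun i => hS.termValue_congr hst (ts i))).trans
      (hS.rel_congr R _ _)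
  | imp φ ψ ihφ ihψ =>
    have h₁ := ihφ (s := t) (t := s) (fun i => (h i).trans (hS.eq_symm _ _).le)
      (fun i => (hxy i).trans (hS.eq_symm _ _).le)
    rw [value_imp, value_imp, le_himp_iff]
    refine le_trans (le_inf (inf_le_left.trans inf_le_left) ?_) (ihψ h hxy)
    refine le_trans (le_inf (inf_le_left.trans inf_le_right) ?_) himp_inf_le
    exact le_trans (le_inf (inf_le_left.trans inf_le_left) inf_le_right) h₁
  | all φ ih =>
    refine le_iInf fun x => (inf_le_inf_left _ (iInf_le _ x)).trans (ih h fun i => ?_)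
    refine Fin.lastCases ?_ (fun i => ?_) i
    · simp [hS.eq_refl]
    · simpa using hxy i

end Interpretation

/-! ### Elementary facts about names -/

namespace bSet

variable {𝔹 : Type u}

/-- The index type of a name. -/
def type : bSet 𝔹 → Type u
  | ⟨α, _, _⟩ => α

/-- The family of names underlying a name. -/
def func : ∀ x : bSet 𝔹, x.type → bSet 𝔹
  | ⟨_, A, _⟩ => A

/-- The family of truth values underlying a name. -/
def bval : ∀ x : bSet 𝔹, x.type → 𝔹
  | ⟨_, _, B⟩ => B

variable [CompleteBooleanAlgebra 𝔹] {Γ b : 𝔹}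

theorem bvMem_def (z x : bSet 𝔹) : bvMem z x = ⨆ i, x.bval i ⊓ bvEq z (x.func i) := by
  cases x; rw [bvMem]; rfl

theorem bvMem_mk (z : bSet 𝔹) {α : Type u} (A : α → bSet 𝔹) (B : α → 𝔹) :
    bvMem z ⟨α, A, B⟩ = ⨆ i, B i ⊓ bvEq z (A i) := by
  rw [bvMem]

theorem bvEq_symm (x y : bSet 𝔹) : bvEq x y = bvEq y x := by
  induction x generalizing y with
  | mk α A B ih =>
    cases y with
    | mk α' A' B' =>
      rw [bvEq, bvEq, inf_comm]
      simp only [ih]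

theorem bvEq_def (x y : bSet 𝔹) : bvEq x y =
    (⨅ i, x.bval i ⇨ bvMem (x.func i) y) ⊓ (⨅ j, y.bval j ⇨ bvMem (y.func j) x) := by
  cases x; cases y
  rw [bvEq]
  simp only [bvMem_mk]
  exact congrArg _ (iInf_congr fun j => congrArg _ (iSup_congr fun i => by rw [bvEq_symm]; rfl))

theorem bvEq_refl (x : bSet 𝔹) : bvEq x x = ⊤ := by
  induction x with
  | mk α A B ih =>
    rw [bvEq_def, inf_idem, iInf_eq_top]
    intro i
    rw [himp_eq_top_iff, bvMem_def]
    refine le_trans ?_ (le_iSup _ i)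
    exact le_inf le_rfl (le_top.trans (ih i).ge)

/-- In this rule and those below, `Γ` acts as a context: `Γ ≤ a` reads "`a` holds under the
assumptions `Γ`", and eliminating a supremum adds an assumption by a meet. -/
theorem iSup_elim {ι : Sort*} {f : ι → 𝔹} (h : Γ ≤ iSup f) (H : ∀ i, Γ ⊓ f i ≤ b) : Γ ≤ b :=
  (le_inf le_rfl h).trans ((inf_iSup_eq _ _).le.trans (iSup_le H))

theorem mem_elim {z x : bSet 𝔹} (h : Γ ≤ bvMem z x)
    (H : ∀ i, Γ ⊓ (x.bval i ⊓ bvEq z (x.func i)) ≤ b) : Γ ≤ b :=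
  iSup_elim (h.trans (bvMem_def z x).le) H

theorem mem_intro {z x : bSet 𝔹} (i : x.type) (h₁ : Γ ≤ x.bval i) (h₂ : Γ ≤ bvEq z (x.func i)) :
    Γ ≤ bvMem z x :=
  (le_inf h₁ h₂).trans ((le_iSup (fun i => x.bval i ⊓ bvEq z (x.func i)) i).trans
    (bvMem_def z x).ge)

theorem bval_le_bvMem (x : bSet 𝔹) (i : x.type) : x.bval i ≤ bvMem (x.func i) x :=
  mem_intro i le_rfl (le_top.trans (bvEq_refl _).ge)

theorem bvEq.mem_right {x y : bSet 𝔹} (h : Γ ≤ bvEq x y) {i : x.type} (hi : Γ ≤ x.bval i) :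
    Γ ≤ bvMem (x.func i) y := by
  rw [bvEq_def] at h
  exact (le_inf (h.trans (inf_le_left.trans (iInf_le _ i))) hi).trans himp_inf_le

theorem bvEq.intro {x y : bSet 𝔹} (h₁ : ∀ i, Γ ⊓ x.bval i ≤ bvMem (x.func i) y)
    (h₂ : ∀ i, Γ ⊓ y.bval i ≤ bvMem (y.func i) x) : Γ ≤ bvEq x y := by
  rw [bvEq_def]
  exact le_inf (le_iInf fun i => le_himp_iff.2 (h₁ i)) (le_iInf fun i => le_himp_iff.2 (h₂ i))

theorem bvEq.symm {x y : bSet 𝔹} (h : Γ ≤ bvEq x y) : Γ ≤ bvEq y x :=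
  h.trans (bvEq_symm x y).le

theorem bvEq.trans {x y z : bSet 𝔹} (h₁ : Γ ≤ bvEq x y) (h₂ : Γ ≤ bvEq y z) : Γ ≤ bvEq x z := by
  induction x generalizing y z Γ with
  | mk α A B ih =>
    refine bvEq.intro (fun i => ?_) (fun k => ?_)
    · refine mem_elim (bvEq.mem_right (inf_le_left.trans h₁) inf_le_right) fun j => ?_
      refine mem_elim (bvEq.mem_right (inf_le_left.trans (inf_le_left.trans h₂))
        (inf_le_right.trans inf_le_left)) fun k => ?_
      exact mem_intro k (inf_le_right.trans inf_le_left)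
        (ih i (inf_le_left.trans (inf_le_right.trans inf_le_right))
          (inf_le_right.trans inf_le_right))
    -- Induction is on `x` alone, so the chain from `z` back to `x` is reversed by symmetry before
    -- the hypothesis for the member `A i` applies.
    · refine mem_elim (bvEq.mem_right (inf_le_left.trans (bvEq.symm h₂)) inf_le_right) fun j => ?_
      refine mem_elim (bvEq.mem_right (inf_le_left.trans (inf_le_left.trans (bvEq.symm h₁)))
        (inf_le_right.trans inf_le_left)) fun i => ?_
      exact mem_intro i (inf_le_right.trans inf_le_left)
        (bvEq.symm (ih i (bvEq.symm (inf_le_right.trans inf_le_right))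
          (bvEq.symm (inf_le_left.trans (inf_le_right.trans inf_le_right)))))

theorem bvMem.congr_left {x y z : bSet 𝔹} (h : Γ ≤ bvEq x y) (hz : Γ ≤ bvMem x z) :
    Γ ≤ bvMem y z :=
  mem_elim hz fun i => mem_intro i (inf_le_right.trans inf_le_left)
    (bvEq.trans (bvEq.symm (inf_le_left.trans h)) (inf_le_right.trans inf_le_right))

theorem bvMem.congr_right {x y z : bSet 𝔹} (h : Γ ≤ bvEq y z) (hx : Γ ≤ bvMem x y) :
    Γ ≤ bvMem x z :=
  mem_elim hx fun _ => bvMem.congr_left (bvEq.symm (inf_le_right.trans inf_le_right))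
    (bvEq.mem_right (inf_le_left.trans h) (inf_le_right.trans inf_le_left))

theorem bvEq.of_forall_mem {x y : bSet 𝔹} (h₁ : ∀ z, Γ ⊓ bvMem z x ≤ bvMem z y)
    (h₂ : ∀ z, Γ ⊓ bvMem z y ≤ bvMem z x) : Γ ≤ bvEq x y :=
  bvEq.intro (fun i => (inf_le_inf_left _ (bval_le_bvMem x i)).trans (h₁ _))
    (fun i => (inf_le_inf_left _ (bval_le_bvMem y i)).trans (h₂ _))

/-- Names form a `𝔹`-valued structure. -/
theorem isStructure_interpretation : (interpretation 𝔹).IsStructure where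
  eq_refl := bvEq_refl
  eq_symm := bvEq_symm
  eq_trans _ _ _ := bvEq.trans inf_le_left inf_le_right
  fun_congr f := Empty.elim f
  rel_congr R x y := by
    cases R
    exact bvMem.congr_right (inf_le_left.trans (iInf_le _ 1))
      (bvMem.congr_left (inf_le_left.trans (iInf_le _ 0)) inf_le_right)

/-! ### Mixtures and the maximum principle -/

/-- The mixture is the union of all `τ i`, with the members of `τ i` weighted by `a i`. A member
contributed by `τ k` counts within `a i` only to the extent `a k ⊓ a i`, where `τ k` and `τ i`
agree. -/
theorem exists_mixture {ι : Type u} (a : ι → 𝔹) (τ : ι → bSet 𝔹)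
    (h : ∀ i j, a i ⊓ a j ≤ bvEq (τ i) (τ j)) : ∃ x, ∀ i, a i ≤ bvEq x (τ i) := by
  refine ⟨⟨Σ i, (τ i).type, fun k => (τ k.1).func k.2, fun k => a k.1 ⊓ (τ k.1).bval k.2⟩,
    fun i => bvEq.intro (fun k => ?_) (fun k => ?_)⟩
  · have hk : a i ⊓ (a k.1 ⊓ (τ k.1).bval k.2) ≤ a k.1 ⊓ a i :=
      le_inf (inf_le_right.trans inf_le_left) inf_le_left
    exact bvEq.mem_right (hk.trans (h k.1 i)) (inf_le_right.trans inf_le_right)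
  · exact mem_intro (x := ⟨Σ i, (τ i).type, fun k => (τ k.1).func k.2,
      fun k => a k.1 ⊓ (τ k.1).bval k.2⟩) ⟨i, k⟩ le_rfl (le_top.trans (bvEq_refl _).ge)

/-- A `𝔹`-valued predicate on names that respects equality of names. -/
def Extensional (F : bSet 𝔹 → 𝔹) : Prop :=
  ∀ x y, bvEq x y ⊓ F x ≤ F y

/-- Each `a i` splits into the part covered by earlier terms, handled by induction, and the
remainder, handled by `h`. -/
theorem iSup_le_of_le_iSup_lt {ι : Type*} {r : ι → ι → Prop} [IsWellFounded ι r] {a : ι → 𝔹}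
    (h : ∀ i, a i ⊓ (⨆ j, ⨆ _ : r j i, a j)ᶜ ≤ b) : ⨆ i, a i ≤ b := by
  refine iSup_le fun i => ?_
  induction i using IsWellFounded.induction r with
  | ind i ih =>
    rw [← sup_inf_inf_compl (x := a i) (y := ⨆ j, ⨆ _ : r j i, a j)]
    exact sup_le (inf_le_right.trans (iSup₂_le ih)) (h i)

theorem Extensional.exists_eq_iSup {F : bSet 𝔹 → 𝔹} (hF : Extensional F) : ∃ x, F x = ⨆ y, F y := by
  -- The names form a large type, but the values of `F` lie in `𝔹`, so one name per value gives a
  -- family small enough to mix. Subtracting the earlier values makes the weights `a` disjoint, and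
  -- the compatibility condition becomes trivial.
  choose τ hτ using fun b : Set.range F => b.2
  let r : Set.range F → Set.range F → Prop := WellOrderingRel
  let a : Set.range F → 𝔹 := fun i => i.1 ⊓ (⨆ j, ⨆ _ : r j i, j.1)ᶜ
  have disj : ∀ i j, r j i → a i ⊓ a j = ⊥ := fun i j hij => by
    have h₁ : a j ≤ ⨆ j, ⨆ _ : r j i, j.1 := inf_le_left.trans (le_iSup₂_of_le j hij le_rfl)
    have h₂ : a i ≤ (⨆ j, ⨆ _ : r j i, j.1)ᶜ := inf_le_right
    exact le_bot_iff.1 ((inf_le_inf h₂ h₁).trans (compl_inf_self _).le)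
  obtain ⟨x, hx⟩ := exists_mixture a τ fun i j => by
    rcases trichotomous_of r i j with h | rfl | h
    · rw [inf_comm, disj _ _ h]
      exact bot_le
    · exact le_top.trans (bvEq_refl _).ge
    · rw [disj _ _ h]
      exact bot_le
  refine ⟨x, le_antisymm (le_iSup F x) (le_trans (iSup_le fun y => ?_)
    (iSup_le_of_le_iSup_lt (r := r) (a := Subtype.val) fun i => ?_))⟩
  · exact le_iSup (Subtype.val : Set.range F → 𝔹) ⟨F y, y, rfl⟩
  · exact (le_inf (bvEq.symm (hx i)) (inf_le_left.trans (hτ i).ge)).trans (hF _ _)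

theorem extensional_value {α : Type v} {n : ℕ} (φ : setLanguage.BoundedFormula α n)
    {s : bSet 𝔹 → α → bSet 𝔹} {xs : bSet 𝔹 → Fin n → bSet 𝔹}
    (hs : ∀ i x y, bvEq x y ≤ bvEq (s x i) (s y i))
    (hxs : ∀ i x y, bvEq x y ≤ bvEq (xs x i) (xs y i)) :
    Extensional fun x => (interpretation 𝔹).value (s x) φ (xs x) := fun x y =>
  isStructure_interpretation.value_congr (hs · x y) φ (hxs · x y)

theorem extensional_value_snoc {α : Type v} {n : ℕ} (s : α → bSet 𝔹)
    (φ : setLanguage.BoundedFormula α (n + 1)) (xs : Fin n → bSet 𝔹) :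
    Extensional fun x => (interpretation 𝔹).value s φ (Fin.snoc xs x) := by
  refine extensional_value φ (fun i x y => le_top.trans (bvEq_refl _).ge) fun i x y => ?_
  refine Fin.lastCases ?_ (fun i => ?_) i
  · simp
  · simp [bvEq_refl]

theorem exists_value_eq_value_ex {α : Type v} {n : ℕ} (s : α → bSet 𝔹)
    (φ : setLanguage.BoundedFormula α (n + 1)) (xs : Fin n → bSet 𝔹) :
    ∃ x, (interpretation 𝔹).value s φ (Fin.snoc xs x) = (interpretation 𝔹).value s φ.ex xs := by
  rw [Interpretation.value_ex]
  exact (extensional_value_snoc s φ xs).exists_eq_iSup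

end bSet

/-! ### Two-valued quotients of the universe of names -/

/-- A two-valued homomorphism, that is, the characteristic function of an ultrafilter. -/
abbrev Point (𝔹 : Type u) [CompleteBooleanAlgebra 𝔹] : Type u := BoundedLatticeHom 𝔹 Prop

namespace Point

variable {𝔹 : Type u} [CompleteBooleanAlgebra 𝔹] (p : Point 𝔹) {a b : 𝔹}

theorem mono (h : a ≤ b) (ha : p a) : p b :=
  OrderHomClass.mono p h ha

@[simp]
theorem inf_iff : p (a ⊓ b) ↔ p a ∧ p b := by
  rw [map_inf]; rfl

@[simp]
theorem sup_iff : p (a ⊔ b) ↔ p a ∨ p b := by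
  rw [map_sup]; rfl

@[simp]
theorem top_iff : p ⊤ ↔ True := by
  rw [map_top]; rfl

@[simp]
theorem bot_iff : p ⊥ ↔ False := by
  rw [map_bot]; rfl

@[simp]
theorem compl_iff : p aᶜ ↔ ¬ p a := by
  rw [map_compl']; rfl

@[simp]
theorem himp_iff : p (a ⇨ b) ↔ (p a → p b) := by
  rw [himp_eq, sup_iff, compl_iff]
  tauto

end Point

/-- If `a ≤ b` fails, a prime ideal separates the filter above `a` from the ideal below `b`; its
complement is a point containing `a` but not `b`. -/
theorem le_of_forall_point {𝔹 : Type u} [CompleteBooleanAlgebra 𝔹] {a b : 𝔹}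
    (h : ∀ p : Point 𝔹, p a → p b) : a ≤ b := by
  by_contra hab
  have hd : Disjoint (Order.PFilter.principal a : Set 𝔹) (Order.Ideal.principal b : Set 𝔹) :=
    Set.disjoint_left.2 fun x h₁ h₂ => hab (le_trans h₁ h₂)
  obtain ⟨J, hJ, hbJ, haJ⟩ := DistribLattice.prime_ideal_of_disjoint_filter_ideal hd
  let p : Point 𝔹 :=
    { toFun := fun x => x ∉ J
      map_sup' := fun x y => by
        simp only [Order.Ideal.sup_mem_iff, not_and_or]; rfl
      map_inf' := fun x y => propext
        ⟨fun hx => ⟨fun h₁ => hx (J.lower inf_le_left h₁), fun h₁ => hx (J.lower inf_le_right h₁)⟩,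
          fun hx h₁ => (hJ.mem_or_mem h₁).elim hx.1 hx.2⟩
      map_top' := eq_true hJ.toIsProper.top_notMem
      map_bot' := eq_false (not_not.2 J.bot_mem) }
  exact h p (Set.disjoint_left.1 haJ (le_refl a)) (hbJ (le_refl b))

theorem eq_top_of_forall_point {𝔹 : Type u} [CompleteBooleanAlgebra 𝔹] {b : 𝔹}
    (h : ∀ p : Point 𝔹, p b) : b = ⊤ :=
  top_le_iff.1 (le_of_forall_point fun p _ => h p)

variable {𝔹 : Type u} [CompleteBooleanAlgebra 𝔹]

namespace bSet

/-- This infinite join is preserved because the maximum principle makes it a single value of `F`. -/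
theorem Extensional.point_iSup {F : bSet 𝔹 → 𝔹} (hF : Extensional F) (p : Point 𝔹) :
    p (⨆ x, F x) ↔ ∃ x, p (F x) := by
  refine ⟨fun h => ?_, fun ⟨x, hx⟩ => p.mono (le_iSup F x) hx⟩
  obtain ⟨x, hx⟩ := hF.exists_eq_iSup
  exact ⟨x, hx ▸ h⟩

theorem Extensional.compl {F : bSet 𝔹 → 𝔹} (hF : Extensional F) :
    Extensional fun x => (F x)ᶜ := fun x y =>
  le_of_forall_point fun p => by
    have := p.mono (hF y x)
    simp only [Point.inf_iff, Point.compl_iff, bvEq_symm y x] at this ⊢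
    tauto

theorem Extensional.point_iInf {F : bSet 𝔹 → 𝔹} (hF : Extensional F) (p : Point 𝔹) :
    p (⨅ x, F x) ↔ ∀ x, p (F x) := by
  rw [← not_iff_not, ← Point.compl_iff, compl_iInf, hF.compl.point_iSup]
  simp

end bSet

/-- Equality of names at a point. -/
def germSetoid (p : Point 𝔹) : Setoid (bSet 𝔹) where
  r x y := p (bSet.bvEq x y)
  iseqv :=
    { refl := fun x => by simp [bSet.bvEq_refl]
      symm := fun h => p.mono (bSet.bvEq_symm _ _).le h
      trans := fun h₁ h₂ => p.mono (bSet.bvEq.trans inf_le_left inf_le_right)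
        (p.inf_iff.2 ⟨h₁, h₂⟩) }

/-- The two-valued quotient of the universe of names at a point. -/
def Germ (p : Point 𝔹) : Type (u + 1) :=
  Quotient (germSetoid p)

namespace Germ

variable {p : Point 𝔹}

/-- The class of a name. -/
def mk (p : Point 𝔹) (x : bSet 𝔹) : Germ p :=
  Quotient.mk _ x

/-- A representing name. -/
noncomputable def out (x : Germ p) : bSet 𝔹 :=
  Quotient.out x

@[simp]
theorem mk_out (x : Germ p) : mk p x.out = x :=
  Quotient.out_eq x

theorem forall_iff {P : Germ p → Prop} : (∀ x, P x) ↔ ∀ x, P (mk p x) :=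
  Quotient.mk_surjective.forall

theorem exists_iff {P : Germ p → Prop} : (∃ x, P x) ↔ ∃ x, P (mk p x) :=
  Quotient.mk_surjective.exists

theorem mk_eq_mk {x y : bSet 𝔹} : mk p x = mk p y ↔ p (bSet.bvEq x y) :=
  Quotient.eq (r := germSetoid p)

/-- Membership in the quotient. -/
def mem (x y : Germ p) : Prop :=
  p (bSet.bvMem x.out y.out)

theorem mem_mk {x y : bSet 𝔹} : mem (mk p x) (mk p y) ↔ p (bSet.bvMem x y) := by
  have hx : p (bSet.bvEq (mk p x).out x) := mk_eq_mk.1 (mk_out _)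
  have hy : p (bSet.bvEq (mk p y).out y) := mk_eq_mk.1 (mk_out _)
  have key : ∀ {a b c d : bSet 𝔹}, p (bSet.bvEq a b) → p (bSet.bvEq c d) → p (bSet.bvMem a c) →
      p (bSet.bvMem b d) := fun {a b c d} h₁ h₂ h₃ =>
    p.mono (bSet.bvMem.congr_right (inf_le_left.trans inf_le_right)
      (bSet.bvMem.congr_left (inf_le_left.trans inf_le_left) inf_le_right))
      (p.inf_iff.2 ⟨p.inf_iff.2 ⟨h₁, h₂⟩, h₃⟩)
  refine ⟨key hx hy, key ?_ ?_⟩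
  · rwa [bSet.bvEq_symm]
  · rwa [bSet.bvEq_symm]

instance : setLanguage.Structure (Germ p) where
  funMap := fun f _ => Empty.elim f
  RelMap := fun R =>
    match R with
    | SetRel.mem => fun xs => mem (xs 0) (xs 1)

theorem realize_term {α : Type v} (s : α → bSet 𝔹) (t : setLanguage.Term α) :
    t.realize (fun i => mk p (s i)) = mk p ((bSet.interpretation 𝔹).termValue s t) := by
  cases t with
  | var k => rfl
  | func f ts => exact Empty.elim f

theorem mk_snoc {n : ℕ} (xs : Fin n → bSet 𝔹) (x : bSet 𝔹) :
    (fun i => mk p ((Fin.snoc xs x : Fin (n + 1) → bSet 𝔹) i)) =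
      (Fin.snoc (fun i => mk p (xs i)) (mk p x) : Fin (n + 1) → Germ p) := by
  funext i
  refine Fin.lastCases ?_ (fun i => ?_) i <;> simp

/-- Łoś's theorem for the quotients of the universe of names. -/
theorem realize_iff_value {α : Type v} {n : ℕ} (φ : setLanguage.BoundedFormula α n)
    (s : α → bSet 𝔹) (xs : Fin n → bSet 𝔹) :
    φ.Realize (fun i => mk p (s i)) (fun i => mk p (xs i)) ↔
      p ((bSet.interpretation 𝔹).value s φ xs) := by
  have hs : ∀ {k} (xs : Fin k → bSet 𝔹), Sum.elim (fun i => mk p (s i)) (fun i => mk p (xs i)) =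
      fun i => mk p (Sum.elim s xs i) := fun xs => by
    funext i
    cases i <;> rfl
  induction φ with
  | falsum => exact p.bot_iff.symm
  | equal t₁ t₂ =>
    change Term.realize _ t₁ = Term.realize _ t₂ ↔ _
    rw [hs, realize_term, realize_term, mk_eq_mk]
    rfl
  | rel R ts =>
    cases R
    change mem (Term.realize _ (ts 0)) (Term.realize _ (ts 1)) ↔ _
    rw [hs, realize_term, realize_term, mem_mk]
    rfl
  | imp φ ψ ihφ ihψ =>
    rw [Interpretation.value_imp, Point.himp_iff, BoundedFormula.realize_imp]
    exact imp_congr (ihφ xs) (ihψ xs)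
  | all φ ih =>
    -- The only case that uses more than the homomorphism laws and compatibility with equality: the
    -- infimum is over all names, so the maximum principle makes `p` commute with it.
    rw [BoundedFormula.realize_all, Interpretation.value_all,
      (bSet.extensional_value_snoc s φ xs).point_iInf, forall_iff]
    simp only [← ih, mk_snoc]

theorem sentence_realize_iff (φ : setLanguage.Sentence) :
    Germ p ⊨ φ ↔ p ((bSet.interpretation 𝔹).truth φ) := by
  refine Iff.trans (iff_of_eq ?_) (realize_iff_value φ Empty.elim Fin.elim0)
  change BoundedFormula.Realize φ _ _ = _
  congr 1 <;> exact Subsingleton.elim _ _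

end Germ

theorem truth_eq_top {φ : setLanguage.Sentence} (h : ∀ p : Point 𝔹, Germ p ⊨ φ) :
    (bSet.interpretation 𝔹).truth φ = ⊤ :=
  eq_top_of_forall_point fun p => (Germ.sentence_realize_iff φ).1 (h p)

/-! ### Realizations of the formulas of set theory -/

namespace Germ

variable {p : Point 𝔹} {n : ℕ} {xs : Fin n → Germ p} {s : Empty → Germ p}

@[simp]
theorem realize_memF {i j : Fin n} : (memF i j).Realize s xs ↔ mem (xs i) (xs j) := by
  exact BoundedFormula.realize_rel₂ (L := setLanguage) (R := SetRel.mem)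

@[simp]
theorem realize_eqF {i j : Fin n} : (eqF i j).Realize s xs ↔ xs i = xs j := by
  rw [eqF, BoundedFormula.realize_bdEqual]
  rfl

@[simp]
theorem realize_subsetF {i j : Fin n} :
    (subsetF i j).Realize s xs ↔ ∀ z, mem z (xs i) → mem z (xs j) := by
  simp [subsetF]

/-- `w = {x, y}`. -/
def IsPair (w x y : Germ p) : Prop :=
  ∀ z, mem z w ↔ z = x ∨ z = y

/-- `w` is the ordered pair `(x, y)`. -/
def IsOrderedPair (w x y : Germ p) : Prop :=
  ∀ z, mem z w ↔ IsPair z x x ∨ IsPair z x y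

/-- `(x, y) ∈ r`. -/
def Related (r x y : Germ p) : Prop :=
  ∃ w, IsOrderedPair w x y ∧ mem w r

@[simp]
theorem realize_isPairF {w i j : Fin n} :
    (isPairF w i j).Realize s xs ↔ IsPair (xs w) (xs i) (xs j) := by
  simp [isPairF, IsPair]

@[simp]
theorem realize_isOrderedPairF {w i j : Fin n} :
    (isOrderedPairF w i j).Realize s xs ↔ IsOrderedPair (xs w) (xs i) (xs j) := by
  simp [isOrderedPairF, IsOrderedPair]

@[simp]
theorem realize_relatedF {r i j : Fin n} :
    (relatedF r i j).Realize s xs ↔ Related (xs r) (xs i) (xs j) := by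
  simp [relatedF, Related]

@[simp]
theorem realize_place {α : Type} (φ : setLanguage.Formula α) (σ : α → Fin n) :
    (place φ σ).Realize s xs ↔ φ.Realize fun k => xs (σ k) := by
  rw [place, BoundedFormula.realize_relabel]
  exact iff_of_eq (congrArg _ (Subsingleton.elim _ _))

end Germ

/-! ### Closure properties of predicates that respect equality -/

namespace bSet

/-- Equal names have the same class at each point, and points separate `𝔹`; so a description of `F`
in the quotients suffices. -/
theorem Extensional.of_point {F : bSet 𝔹 → 𝔹} (P : ∀ p : Point 𝔹, Germ p → Prop)
    (h : ∀ p x, p (F x) ↔ P p (Germ.mk p x)) : Extensional F := fun x y =>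
  le_of_forall_point fun p => by
    rw [Point.inf_iff, ← Germ.mk_eq_mk, h, h]
    rintro ⟨h₁, h₂⟩
    rwa [← h₁]

theorem extensional_bvMem_left (y : bSet 𝔹) : Extensional fun x => bvMem x y :=
  .of_point (fun _ x => Germ.mem x (Germ.mk _ y)) fun _ _ => Germ.mem_mk.symm

theorem extensional_bvMem_right (y : bSet 𝔹) : Extensional fun x => bvMem y x :=
  .of_point (fun _ x => Germ.mem (Germ.mk _ y) x) fun _ _ => Germ.mem_mk.symm

theorem Extensional.inf {F G : bSet 𝔹 → 𝔹} (hF : Extensional F) (hG : Extensional G) :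
    Extensional fun x => F x ⊓ G x := fun x y =>
  le_inf ((inf_le_inf_left _ inf_le_left).trans (hF x y))
    ((inf_le_inf_left _ inf_le_right).trans (hG x y))

theorem Extensional.himp {F G : bSet 𝔹 → 𝔹} (hF : Extensional F) (hG : Extensional G) :
    Extensional fun x => F x ⇨ G x := fun x y => by
  refine le_himp_iff.2 ?_
  have h₁ : bvEq x y ⊓ (F x ⇨ G x) ⊓ F y ≤ F x :=
    (le_inf (bvEq.symm (inf_le_left.trans inf_le_left)) inf_le_right).trans (hF y x)
  have h₂ : bvEq x y ⊓ (F x ⇨ G x) ⊓ F y ≤ G x :=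
    (le_inf (inf_le_left.trans inf_le_right) h₁).trans himp_inf_le
  exact (le_inf (inf_le_left.trans inf_le_left) h₂).trans (hG x y)

theorem Extensional.iSup {ι : Sort*} {F : ι → bSet 𝔹 → 𝔹} (hF : ∀ i, Extensional (F i)) :
    Extensional fun x => ⨆ i, F i x := fun x y => by
  rw [inf_iSup_eq]
  exact iSup_mono fun i => hF i x y

theorem Extensional.iInf {ι : Sort*} {F : ι → bSet 𝔹 → 𝔹} (hF : ∀ i, Extensional (F i)) :
    Extensional fun x => ⨅ i, F i x := fun x y =>
  le_iInf fun i => (inf_le_inf_left _ (iInf_le _ i)).trans (hF i x y)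

/-! ### Constructions of names -/

theorem exists_bvMem_eq_bot : ∃ e : bSet 𝔹, ∀ z, bvMem z e = ⊥ :=
  ⟨⟨PEmpty, PEmpty.elim, PEmpty.elim⟩, fun z => by rw [bvMem_mk, iSup_of_empty]⟩

theorem exists_bvMem_pair (x y : bSet 𝔹) : ∃ w, ∀ z, bvMem z w = bvEq z x ⊔ bvEq z y :=
  ⟨⟨ULift Bool, fun i => cond i.down x y, fun _ => ⊤⟩, fun z => by
    rw [bvMem_mk, ← Equiv.ulift.symm.iSup_comp, iSup_bool_eq]
    simp⟩

theorem exists_bvMem_union (x : bSet 𝔹) :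
    ∃ w, ∀ z, bvMem z w = ⨆ y, bvMem y x ⊓ bvMem z y := by
  refine ⟨⟨Σ i, (x.func i).type, fun k => (x.func k.1).func k.2,
    fun k => x.bval k.1 ⊓ (x.func k.1).bval k.2⟩, fun z => ?_⟩
  rw [bvMem_mk, iSup_sigma]
  simp only [inf_assoc, ← inf_iSup_eq, ← bvMem_def]
  refine le_antisymm (iSup_le fun i => ?_) (iSup_le fun y => ?_)
  · exact le_iSup_of_le (x.func i) (inf_le_inf_right _ (bval_le_bvMem x i))
  · refine mem_elim (z := y) (x := x) inf_le_left fun i => le_iSup_of_le i ?_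
    exact le_inf (inf_le_right.trans inf_le_left) (bvMem.congr_right
      (inf_le_right.trans inf_le_right) (inf_le_left.trans inf_le_right))

theorem bvMem_comprehension (x : bSet 𝔹) {F : bSet 𝔹 → 𝔹} (hF : Extensional F) (z : bSet 𝔹) :
    bvMem z ⟨x.type, x.func, fun i => x.bval i ⊓ F (x.func i)⟩ = bvMem z x ⊓ F z := by
  refine le_antisymm ?_ (mem_elim (z := z) (x := x) inf_le_left fun i => ?_)
  · rw [bvMem_mk]
    refine iSup_le fun i => le_inf (mem_intro i (inf_le_left.trans inf_le_left) inf_le_right) ?_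
    exact (le_inf (bvEq.symm inf_le_right) (inf_le_left.trans inf_le_right)).trans (hF _ z)
  · rw [bvMem_mk]
    refine le_iSup_of_le i (le_inf (le_inf (inf_le_right.trans inf_le_left) ?_)
      (inf_le_right.trans inf_le_right))
    exact (le_inf (inf_le_right.trans inf_le_right) (inf_le_left.trans inf_le_right)).trans
      (hF z _)

/-- Any subset of `x` equals a name `S f` on the index type of `x`, differing only in its truth
values, so the small type `x.type → 𝔹` indexes enough candidates. Since `f` is arbitrary, `S f` need
not be a subset of `x`; the weight `G (S f)` corrects this. -/
theorem exists_bvMem_powerSet (x : bSet 𝔹) :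
    ∃ w, ∀ z, bvMem z w = ⨅ y, bvMem y z ⇨ bvMem y x := by
  let S : (x.type → 𝔹) → bSet 𝔹 := fun f => ⟨x.type, x.func, f⟩
  let G : bSet 𝔹 → 𝔹 := fun z => ⨅ y, bvMem y z ⇨ bvMem y x
  have hG : Extensional G := .iInf fun y => .himp (extensional_bvMem_right y) (.of_point
    (fun p _ => Germ.mem (Germ.mk p y) (Germ.mk p x)) fun _ _ => Germ.mem_mk.symm)
  refine ⟨⟨x.type → 𝔹, S, fun f => G (S f)⟩, fun z => le_antisymm ?_ ?_⟩
  · rw [bvMem_mk]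
    exact iSup_le fun f => (le_inf (bvEq.symm inf_le_right) inf_le_left).trans (hG _ z)
  · let f : x.type → 𝔹 := fun i => x.bval i ⊓ bvMem (x.func i) z
    have hf : ∀ y, bvMem y (S f) = bvMem y x ⊓ bvMem y z :=
      bvMem_comprehension x (extensional_bvMem_left z)
    have hz : G z ≤ bvEq z (S f) := by
      refine bvEq.of_forall_mem (fun y => ?_) (fun y => ?_) <;> rw [hf]
      · exact le_inf ((inf_le_inf_right _ (iInf_le _ y)).trans himp_inf_le) inf_le_right
      · exact inf_le_right.trans inf_le_right
    rw [bvMem_mk]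
    exact le_iSup_of_le f (le_inf ((le_inf hz le_rfl).trans (hG z _)) hz)

/-- The maximum principle yields one best witness for each index of `a`, and these form a name; no
rank argument is needed. -/
theorem exists_collection {G : bSet 𝔹 → bSet 𝔹 → 𝔹} (h₁ : ∀ y, Extensional (G · y))
    (h₂ : ∀ x, Extensional (G x)) (a : bSet 𝔹) :
    ∃ b, ∀ x, bvMem x a ⊓ ⨆ y, G x y ≤ ⨆ y, bvMem y b ⊓ G x y := by
  choose y hy using fun i => (h₂ (a.func i)).exists_eq_iSup
  refine ⟨⟨a.type, y, fun _ => ⊤⟩, fun x => mem_elim (z := x) (x := a) inf_le_left fun i => ?_⟩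
  refine le_iSup_of_le (y i) (le_inf (mem_intro (x := ⟨a.type, y, fun _ => ⊤⟩) i le_top
    (le_top.trans (bvEq_refl _).ge)) ?_)
  have hx : bvMem x a ⊓ (⨆ y, G x y) ⊓ (a.bval i ⊓ bvEq x (a.func i)) ≤ bvEq x (a.func i) :=
    inf_le_right.trans inf_le_right
  have h : bvMem x a ⊓ (⨆ y, G x y) ⊓ (a.bval i ⊓ bvEq x (a.func i)) ≤ G (a.func i) (y i) := by
    rw [hy]
    exact (le_inf hx (inf_le_left.trans inf_le_right)).trans (Extensional.iSup h₁ _ _)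
  exact (le_inf (bvEq.symm hx) h).trans (h₁ _ _ _)

/-- The successor `x ∪ {x}`. -/
def succ (x : bSet 𝔹) : bSet 𝔹 :=
  ⟨Option x.type, fun i => i.elim x x.func, fun i => i.elim ⊤ x.bval⟩

theorem bvMem_succ (z x : bSet 𝔹) : bvMem z x.succ = bvMem z x ⊔ bvEq z x := by
  rw [succ, bvMem_mk, iSup_option, bvMem_def, sup_comm]
  simp

theorem succ_congr {Γ : 𝔹} {x y : bSet 𝔹} (h : Γ ≤ bvEq x y) : Γ ≤ bvEq x.succ y.succ := by
  refine bvEq.of_forall_mem (fun z => ?_) fun z => ?_ <;> rw [bvMem_succ, bvMem_succ, inf_sup_left]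
  · exact sup_le_sup (bvMem.congr_right (inf_le_left.trans h) inf_le_right)
      (bvEq.trans inf_le_right (inf_le_left.trans h))
  · exact sup_le_sup (bvMem.congr_right (bvEq.symm (inf_le_left.trans h)) inf_le_right)
      (bvEq.trans inf_le_right (bvEq.symm (inf_le_left.trans h)))

theorem exists_inductive (e : bSet 𝔹) :
    ∃ w, bvMem e w = ⊤ ∧ ∀ x, bvMem x w ≤ bvMem x.succ w := by
  refine ⟨⟨ULift ℕ, fun k => succ^[k.down] e, fun _ => ⊤⟩, ?_, fun x => ?_⟩
  · exact top_le_iff.1 (mem_intro (x := ⟨ULift ℕ, fun k => succ^[k.down] e, fun _ => ⊤⟩) ⟨0⟩ le_rfl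
      (bvEq_refl e).ge)
  · refine mem_elim le_rfl fun k =>
      mem_intro (x := ⟨ULift ℕ, fun k => succ^[k.down] e, fun _ => ⊤⟩) ⟨k.down + 1⟩ le_top ?_
    refine (succ_congr (inf_le_right.trans inf_le_right)).trans (le_of_eq (congrArg _ ?_))
    exact (Function.iterate_succ_apply' succ k.down e).symm

/-- Induction on membership, as a bound on truth values. -/
theorem bvMem_inf_eq_bot {x : bSet 𝔹} {b : 𝔹} (h : ∀ y, b ⊓ bvMem y x ≤ ⨆ z, bvMem z y ⊓ bvMem z x)
    (y : bSet 𝔹) : b ⊓ bvMem y x = ⊥ := by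
  induction y with
  | mk α A B ih =>
    refine le_bot_iff.1 (iSup_elim (h _) fun z => ?_)
    refine mem_elim (z := z) (x := ⟨α, A, B⟩) (inf_le_right.trans inf_le_left) fun i => ?_
    refine le_trans (le_inf (inf_le_left.trans (inf_le_left.trans inf_le_left)) ?_) (ih i).le
    exact bvMem.congr_left (inf_le_right.trans inf_le_right)
      (inf_le_left.trans (inf_le_right.trans inf_le_right))

end bSet

/-! ### The axioms of ZFC other than choice -/

namespace Germ

open bSet

variable {p : Point 𝔹}

theorem realize_extensionality : Germ p ⊨ extensionality := by
  suffices H : ∀ x y : Germ p, (∀ z, mem z x ↔ mem z y) → x = y by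
    simpa [extensionality, Sentence.Realize, Formula.Realize, Fin.snoc] using H
  simp only [forall_iff, mem_mk, mk_eq_mk]
  intro x y h
  have hF : ∀ a b : bSet 𝔹, Extensional fun z => bvMem z a ⇨ bvMem z b := fun a b =>
    (extensional_bvMem_left a).himp (extensional_bvMem_left b)
  have hle : (⨅ z, bvMem z x ⇨ bvMem z y) ⊓ (⨅ z, bvMem z y ⇨ bvMem z x) ≤ bvEq x y :=
    bvEq.of_forall_mem
      (fun z => (inf_le_inf_right _ (inf_le_left.trans (iInf_le _ z))).trans himp_inf_le)
      (fun z => (inf_le_inf_right _ (inf_le_right.trans (iInf_le _ z))).trans himp_inf_le)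
  refine p.mono hle ?_
  rw [Point.inf_iff, (hF x y).point_iInf, (hF y x).point_iInf]
  simp only [Point.himp_iff]
  exact ⟨fun z => (h z).1, fun z => (h z).2⟩

theorem realize_emptySet : Germ p ⊨ emptySet := by
  suffices H : ∃ x : Germ p, ∀ z, ¬ mem z x by
    simpa [emptySet, Sentence.Realize, Formula.Realize, Fin.snoc] using H
  simp only [forall_iff, exists_iff, mem_mk]
  obtain ⟨e, he⟩ := exists_bvMem_eq_bot (𝔹 := 𝔹)
  exact ⟨e, fun z => by simp [he]⟩

theorem realize_pairing : Germ p ⊨ pairing := by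
  suffices H : ∀ x y : Germ p, ∃ w, IsPair w x y by
    simpa [pairing, Sentence.Realize, Formula.Realize, Fin.snoc] using H
  simp only [IsPair, forall_iff, exists_iff, mem_mk, mk_eq_mk]
  intro x y
  obtain ⟨w, hw⟩ := exists_bvMem_pair x y
  exact ⟨w, fun z => by simp [hw]⟩

theorem realize_union : Germ p ⊨ union := by
  suffices H : ∀ x : Germ p, ∃ w, ∀ z, mem z w ↔ ∃ y, mem y x ∧ mem z y by
    simpa [union, Sentence.Realize, Formula.Realize, Fin.snoc] using H
  simp only [forall_iff, exists_iff, mem_mk]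
  intro x
  obtain ⟨w, hw⟩ := exists_bvMem_union x
  refine ⟨w, fun z => ?_⟩
  rw [hw, ((extensional_bvMem_left x).inf (extensional_bvMem_right z)).point_iSup]
  simp only [Point.inf_iff]

theorem realize_powerSet : Germ p ⊨ powerSet := by
  suffices H : ∀ x : Germ p, ∃ w, ∀ z, mem z w ↔ ∀ y, mem y z → mem y x by
    simpa [powerSet, Sentence.Realize, Formula.Realize, Fin.snoc] using H
  simp only [forall_iff, exists_iff, mem_mk]
  intro x
  obtain ⟨w, hw⟩ := exists_bvMem_powerSet x
  refine ⟨w, fun z => ?_⟩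
  rw [hw, ((extensional_bvMem_left z).himp (extensional_bvMem_left x)).point_iInf]
  simp only [Point.himp_iff]

theorem realize_infinity : Germ p ⊨ infinity := by
  suffices H : ∃ w : Germ p, (∃ e, mem e w ∧ ∀ z, ¬ mem z e) ∧
      ∀ x, mem x w → ∃ s, mem s w ∧ ∀ z, mem z s ↔ mem z x ∨ z = x by
    simpa [infinity, Sentence.Realize, Formula.Realize, Fin.snoc] using H
  simp only [forall_iff, exists_iff, mem_mk, mk_eq_mk]
  obtain ⟨e, he⟩ := exists_bvMem_eq_bot (𝔹 := 𝔹)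
  obtain ⟨w, hw, hs⟩ := exists_inductive e
  exact ⟨w, ⟨e, by simp [hw], fun z => by simp [he]⟩, fun x hx =>
    ⟨x.succ, p.mono (hs x) hx, fun z => by simp [bvMem_succ]⟩⟩

theorem realize_regularity : Germ p ⊨ regularity := by
  suffices H : ∀ x : Germ p, (∃ y, mem y x) → ∃ y, mem y x ∧ ¬ ∃ z, mem z y ∧ mem z x by
    simpa [regularity, Sentence.Realize, Formula.Realize, Fin.snoc] using H
  simp only [forall_iff, exists_iff, mem_mk]
  rintro x ⟨y, hy⟩
  by_contra! hcon
  let F : bSet 𝔹 → 𝔹 := fun y => bvMem y x ⇨ ⨆ z, bvMem z y ⊓ bvMem z x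
  have hG : ∀ y, Extensional fun z => bvMem z y ⊓ bvMem z x := fun y =>
    (extensional_bvMem_left y).inf (extensional_bvMem_left x)
  have hF : Extensional F := (extensional_bvMem_left x).himp
    (.of_point (fun q y => ∃ z, mem z y ∧ mem z (mk q x)) fun q y => by
      rw [(hG y).point_iSup, exists_iff]
      simp only [Point.inf_iff, mem_mk])
  -- The infimum of `F` says that no member of `x` is disjoint from `x`. The quotient need not be
  -- well-founded, so the induction runs over names, in `𝔹`.
  have hb := bvMem_inf_eq_bot (x := x) (b := ⨅ y, F y)
    (fun y => (inf_le_inf_right _ (iInf_le _ y)).trans himp_inf_le) y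
  have hp : p ((⨅ y, F y) ⊓ bvMem y x) := by
    rw [Point.inf_iff, hF.point_iInf]
    refine ⟨fun y => ?_, hy⟩
    simp only [F, Point.himp_iff, (hG y).point_iSup, Point.inf_iff]
    exact hcon y
  rw [hb] at hp
  exact p.bot_iff.1 hp

/-! ### Separation, collection and replacement -/

variable {n : ℕ}

theorem realize_place_of_eq {α : Type} {φ : setLanguage.Formula α} {m : ℕ} {σ : α → Fin m}
    {s : Empty → Germ p} {ys : Fin m → Germ p} {v : α → Germ p} (h : ∀ k, ys (σ k) = v k) :
    (place φ σ).Realize s ys ↔ φ.Realize v := by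
  rw [realize_place]
  exact iff_of_eq (congrArg _ (funext h))

theorem snoc_castAdd_three {M : Type*} (xs : Fin n → M) (a b c : M) (k : Fin n) :
    (Fin.snoc (Fin.snoc (Fin.snoc xs a : Fin (n + 1) → M) b : Fin (n + 2) → M) c :
      Fin (n + 3) → M) (Fin.castAdd 3 k) = xs k := by
  have := k.2
  simp only [Fin.snoc, Fin.val_castAdd, Fin.val_castLT]
  rw [dif_pos (by omega), dif_pos (by omega), dif_pos this]
  rfl

theorem snoc_castAdd_four {M : Type*} (xs : Fin n → M) (a b c d : M) (k : Fin n) :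
    (Fin.snoc (Fin.snoc (Fin.snoc (Fin.snoc xs a : Fin (n + 1) → M) b : Fin (n + 2) → M) c :
      Fin (n + 3) → M) d : Fin (n + 4) → M) (Fin.castAdd 4 k) = xs k := by
  have := k.2
  simp only [Fin.snoc, Fin.val_castAdd, Fin.val_castLT]
  rw [dif_pos (by omega), dif_pos (by omega), dif_pos (by omega), dif_pos this]
  rfl

/-- The truth value of a formula with parameters `xs` and further arguments `ys`. -/
def formulaValue {k : ℕ} (φ : setLanguage.Formula (Fin n ⊕ Fin k)) (xs : Fin n → bSet 𝔹)
    (ys : Fin k → bSet 𝔹) : 𝔹 :=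
  (interpretation 𝔹).value (Sum.elim xs ys) φ Fin.elim0

theorem formulaValue_iff {k : ℕ} {φ : setLanguage.Formula (Fin n ⊕ Fin k)} {xs : Fin n → bSet 𝔹}
    {ys : Fin k → bSet 𝔹} : p (formulaValue φ xs ys) ↔
      φ.Realize (Sum.elim (fun i => mk p (xs i)) fun i => mk p (ys i)) := by
  rw [formulaValue, ← realize_iff_value, Formula.Realize]
  refine iff_of_eq ?_
  congr 1
  · funext i
    cases i <;> rfl
  · exact Subsingleton.elim _ _

theorem formulaValue_one_iff {φ : setLanguage.Formula (Fin n ⊕ Fin 1)} {xs : Fin n → bSet 𝔹}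
    {x : bSet 𝔹} : p (formulaValue φ xs ![x]) ↔
      φ.Realize (Sum.elim (fun i => mk p (xs i)) ![mk p x]) := by
  rw [formulaValue_iff]
  refine iff_of_eq (congrArg (fun v => φ.Realize (Sum.elim _ v)) (funext fun i => ?_))
  fin_cases i
  rfl

theorem formulaValue_two_iff {φ : setLanguage.Formula (Fin n ⊕ Fin 2)} {xs : Fin n → bSet 𝔹}
    {x y : bSet 𝔹} : p (formulaValue φ xs ![x, y]) ↔
      φ.Realize (Sum.elim (fun i => mk p (xs i)) ![mk p x, mk p y]) := by
  rw [formulaValue_iff]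
  refine iff_of_eq (congrArg (fun v => φ.Realize (Sum.elim _ v)) (funext fun i => ?_))
  fin_cases i <;> rfl

theorem exists_mk_comp_eq (xs : Fin n → Germ p) :
    ∃ ys : Fin n → bSet 𝔹, (fun i => mk p (ys i)) = xs :=
  ⟨fun i => (xs i).out, funext fun i => mk_out (xs i)⟩

theorem exists_separation (a : bSet 𝔹) {F : bSet 𝔹 → 𝔹} (hF : Extensional F) :
    ∃ b, ∀ z, p (bvMem z b) ↔ p (bvMem z a) ∧ p (F z) :=
  ⟨_, fun z => by rw [bvMem_comprehension a hF, Point.inf_iff]⟩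

theorem realize_separation (φ : setLanguage.Formula (Fin n ⊕ Fin 1)) :
    Germ p ⊨ separation n φ := by
  rw [separation, Sentence.Realize, BoundedFormula.realize_alls]
  intro xs
  have key : ∀ (s : Empty → Germ p) a b z, (place (m := n + 3) φ
      (Sum.elim (Fin.castAdd 3) ![Fin.natAdd n 2])).Realize s
        (Fin.snoc (Fin.snoc (Fin.snoc xs a) b) z) ↔ φ.Realize (Sum.elim xs ![z]) := by
    refine fun s a b z => realize_place_of_eq fun k => ?_
    rcases k with k | k
    · exact snoc_castAdd_three ..
    · fin_cases k
      simp [Fin.snoc]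
  suffices H : ∀ a, ∃ b : Germ p, ∀ z, mem z b ↔ mem z a ∧ φ.Realize (Sum.elim xs ![z]) by
    simp only [BoundedFormula.realize_all, BoundedFormula.realize_ex, BoundedFormula.realize_iff,
      BoundedFormula.realize_inf, key, realize_memF]
    simpa [Fin.snoc] using H
  obtain ⟨xs, rfl⟩ := exists_mk_comp_eq xs
  simp only [forall_iff, exists_iff, mem_mk, ← formulaValue_one_iff]
  exact fun a => exists_separation a (.of_point
    (fun q z => φ.Realize (Sum.elim (fun i => mk q (xs i)) ![z])) fun q z => formulaValue_one_iff)

theorem exists_collecting_set (φ : setLanguage.Formula (Fin n ⊕ Fin 2)) (xs : Fin n → bSet 𝔹)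
    (a : bSet 𝔹) : ∃ b, ∀ x, p (bvMem x a) → (∃ y, p (formulaValue φ xs ![x, y])) →
      ∃ y, p (bvMem y b) ∧ p (formulaValue φ xs ![x, y]) := by
  have h₁ : ∀ y, Extensional fun x => formulaValue φ xs ![x, y] := fun y => .of_point
    (fun q x => φ.Realize (Sum.elim (fun i => mk q (xs i)) ![x, mk q y]))
    fun _ _ => formulaValue_two_iff
  have h₂ : ∀ x, Extensional fun y => formulaValue φ xs ![x, y] := fun x => .of_point
    (fun q y => φ.Realize (Sum.elim (fun i => mk q (xs i)) ![mk q x, y]))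
    fun _ _ => formulaValue_two_iff
  obtain ⟨b, hb⟩ := exists_collection h₁ h₂ a
  refine ⟨b, fun x hx hy => ?_⟩
  have h := p.mono (hb x) (p.inf_iff.2 ⟨hx, ((h₂ x).point_iSup p).2 hy⟩)
  rw [((extensional_bvMem_left b).inf (h₂ x)).point_iSup] at h
  simpa only [Point.inf_iff] using h

theorem realize_collection (φ : setLanguage.Formula (Fin n ⊕ Fin 2)) :
    Germ p ⊨ collection n φ := by
  rw [collection, Sentence.Realize, BoundedFormula.realize_alls]
  intro xs
  have key₁ : ∀ (s : Empty → Germ p) a x y, (place (m := n + 3) φ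
      (Sum.elim (Fin.castAdd 3) ![Fin.natAdd n 1, Fin.natAdd n 2])).Realize s
        (Fin.snoc (Fin.snoc (Fin.snoc xs a) x) y) ↔ φ.Realize (Sum.elim xs ![x, y]) := by
    refine fun s a x y => realize_place_of_eq fun k => ?_
    rcases k with k | k
    · exact snoc_castAdd_three ..
    · fin_cases k <;> simp [Fin.snoc]
  have key₂ : ∀ (s : Empty → Germ p) a b x y, (place (m := n + 4) φ
      (Sum.elim (Fin.castAdd 4) ![Fin.natAdd n 2, Fin.natAdd n 3])).Realize s
        (Fin.snoc (Fin.snoc (Fin.snoc (Fin.snoc xs a) b) x) y) ↔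
          φ.Realize (Sum.elim xs ![x, y]) := by
    refine fun s a b x y => realize_place_of_eq fun k => ?_
    rcases k with k | k
    · exact snoc_castAdd_four ..
    · fin_cases k <;> simp [Fin.snoc]
  suffices H : ∀ a : Germ p, (∀ x, mem x a → ∃ y, φ.Realize (Sum.elim xs ![x, y])) →
      ∃ b, ∀ x, mem x a → ∃ y, mem y b ∧ φ.Realize (Sum.elim xs ![x, y]) by
    simp only [BoundedFormula.realize_all, BoundedFormula.realize_ex, BoundedFormula.realize_imp,
      BoundedFormula.realize_inf, key₁, key₂, realize_memF]
    simpa [Fin.snoc] using H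
  obtain ⟨xs, rfl⟩ := exists_mk_comp_eq xs
  simp only [forall_iff, exists_iff, mem_mk, ← formulaValue_two_iff]
  intro a h
  obtain ⟨b, hb⟩ := exists_collecting_set (p := p) φ xs a
  exact ⟨b, fun x hx => hb x hx (h x hx)⟩

theorem realize_replacement (φ : setLanguage.Formula (Fin n ⊕ Fin 2)) :
    Germ p ⊨ replacement n φ := by
  rw [replacement, Sentence.Realize, BoundedFormula.realize_alls]
  intro xs
  have key : ∀ (i j : Fin 4) (s : Empty → Germ p) a b c d, (place (m := n + 4) φ
      (Sum.elim (Fin.castAdd 4) ![Fin.natAdd n i, Fin.natAdd n j])).Realize s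
        (Fin.snoc (Fin.snoc (Fin.snoc (Fin.snoc xs a) b) c) d) ↔
          φ.Realize (Sum.elim xs ![![a, b, c, d] i, ![a, b, c, d] j]) := by
    refine fun i j s a b c d => realize_place_of_eq fun k => ?_
    rcases k with k | k
    · exact snoc_castAdd_four ..
    · fin_cases k
      · fin_cases i <;> simp [Fin.snoc]
      · fin_cases j <;> simp [Fin.snoc]
  suffices H : ∀ a : Germ p, (∀ x, mem x a → ∀ y z, φ.Realize (Sum.elim xs ![x, y]) →
      φ.Realize (Sum.elim xs ![x, z]) → y = z) →
      ∃ b, ∀ y, mem y b ↔ ∃ x, mem x a ∧ φ.Realize (Sum.elim xs ![x, y]) by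
    simp only [BoundedFormula.realize_all, BoundedFormula.realize_ex, BoundedFormula.realize_imp,
      BoundedFormula.realize_inf, BoundedFormula.realize_iff, key, realize_memF, realize_eqF]
    simpa [Fin.snoc] using H
  obtain ⟨xs, rfl⟩ := exists_mk_comp_eq xs
  simp only [forall_iff, exists_iff, mem_mk, mk_eq_mk, ← formulaValue_two_iff]
  intro a h
  obtain ⟨b, hb⟩ := exists_collecting_set (p := p) φ xs a
  have hF : ∀ y, Extensional fun x => bvMem x a ⊓ formulaValue φ xs ![x, y] := fun y =>
    (extensional_bvMem_left a).inf (.of_point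
      (fun q x => φ.Realize (Sum.elim (fun i => mk q (xs i)) ![x, mk q y]))
      fun _ _ => formulaValue_two_iff)
  have hG : Extensional fun y => ⨆ x, bvMem x a ⊓ formulaValue φ xs ![x, y] := .of_point
    (fun q y => ∃ x, mem x (mk q a) ∧ φ.Realize (Sum.elim (fun i => mk q (xs i)) ![x, y]))
    fun q y => by
      rw [(hF y).point_iSup, exists_iff]
      simp only [Point.inf_iff, mem_mk, formulaValue_two_iff]
  -- The image is cut out of the collecting set `b`.
  obtain ⟨c, hc⟩ := exists_separation (p := p) b hG
  refine ⟨c, fun y => ?_⟩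
  rw [hc, (hF y).point_iSup]
  simp only [Point.inf_iff]
  refine ⟨And.right, fun ⟨x, hx, hxy⟩ => ⟨?_, x, hx, hxy⟩⟩
  -- Collection puts only some value `z` at `x` into `b`; functionality identifies it with `y`.
  obtain ⟨z, hz, hxz⟩ := hb x hx ⟨y, hxy⟩
  have hyz := h x hx z y hxz hxy
  exact p.mono (extensional_bvMem_left b z y) (p.inf_iff.2 ⟨hyz, hz⟩)

end Germ

open bSet

/-- An implication has truth value `⊤` if its conclusion holds at every point at which the
truth value of its hypothesis holds. -/
theorem Germ.realize_imp_of_forall {p : Point 𝔹} {n : ℕ} {φ ψ : SetFormula n}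
    (H : ∀ (xs : Fin n → bSet 𝔹) (h : 𝔹),
      (∀ q : Point 𝔹, q h → φ.Realize default fun i => Germ.mk q (xs i)) →
      ∀ q : Point 𝔹, q h → ψ.Realize default fun i => Germ.mk q (xs i))
    (xs : Fin n → Germ p) : (φ.imp ψ).Realize default xs := by
  obtain ⟨xs, rfl⟩ := exists_mk_comp_eq xs
  have hv : ∀ q : Point 𝔹, q ((interpretation 𝔹).value Empty.elim φ xs) ↔
      φ.Realize default fun i => Germ.mk q (xs i) := fun q => by
    rw [← Germ.realize_iff_value]
    exact iff_of_eq (congrArg (fun s => φ.Realize s _) (Subsingleton.elim _ _))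
  exact fun h => H xs _ (fun q => (hv q).1) p ((hv p).2 h)

/-! ### The axiom of choice -/

/-- Several indices of `x` may name the same set, to some extent, and contribute different elements.
With the indices well-ordered, `c i` is the extent to which `x.func i` belongs to `x` and differs
from all earlier members. So at each point every class is represented by at most one index, and `s`
takes the chosen element `t i` with weight `c i`. -/
theorem exists_choice_set (x : bSet 𝔹) (h : 𝔹)
    (hne : ∀ q : Point 𝔹, q h → ∀ y, Germ.mem y (Germ.mk q x) → ∃ z, Germ.mem z y)
    (hdisj : ∀ q : Point 𝔹, q h → ∀ y z, Germ.mem y (Germ.mk q x) → Germ.mem z (Germ.mk q x) →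
      ∀ w, Germ.mem w y → Germ.mem w z → y = z) :
    ∃ s, ∀ q : Point 𝔹, q h → ∀ y, Germ.mem y (Germ.mk q x) →
      ∃ z, (Germ.mem z (Germ.mk q s) ∧ Germ.mem z y) ∧
        ∀ w, Germ.mem w (Germ.mk q s) → Germ.mem w y → w = z := by
  let r : x.type → x.type → Prop := WellOrderingRel
  let e : x.type → 𝔹 := fun i => ⨆ j, ⨆ _ : r j i, x.bval j ⊓ bvEq (x.func i) (x.func j)
  let c : x.type → 𝔹 := fun i => x.bval i ⊓ (e i)ᶜ
  -- By the maximum principle, `t i` belongs to `x.func i` as far as the latter is nonempty.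
  choose t ht using fun i => (extensional_bvMem_left (x.func i)).exists_eq_iSup
  let s : bSet 𝔹 := ⟨x.type, t, c⟩
  -- every element of `x` is equal to a member whose index is least
  have hleast : ∀ i, x.bval i ≤ ⨆ j, c j ⊓ bvEq (x.func i) (x.func j) := fun i => by
    induction i using IsWellFounded.induction r with
    | ind i ih =>
      rw [← sup_inf_inf_compl (x := x.bval i) (y := e i)]
      refine sup_le (inf_le_right.trans (iSup₂_le fun j hj => ?_)) ?_
      · refine iSup_elim (inf_le_left.trans (ih j hj)) fun k => le_iSup_of_le k (le_inf
          (inf_le_right.trans inf_le_left) (bvEq.trans (inf_le_left.trans inf_le_right)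
            (inf_le_right.trans inf_le_right)))
      · exact le_iSup_of_le i (le_inf le_rfl (le_top.trans (bvEq_refl _).ge))
  have hindex : ∀ q : Point 𝔹, ∀ i j, q (c i) → q (c j) →
      Germ.mk q (x.func i) = Germ.mk q (x.func j) → i = j := by
    have key : ∀ q : Point 𝔹, ∀ i j, q (c i) → q (c j) →
        Germ.mk q (x.func i) = Germ.mk q (x.func j) → ¬ r j i := fun q i j hi hj hij hr => by
      refine q.compl_iff.1 (q.inf_iff.1 hi).2 (q.mono (le_iSup₂_of_le j hr le_rfl) ?_)
      exact q.inf_iff.2 ⟨(q.inf_iff.1 hj).1, Germ.mk_eq_mk.1 hij⟩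
    intro q i j hi hj hij
    rcases trichotomous_of r i j with hr | hr | hr
    exacts [(key q j i hj hi hij.symm hr).elim, hr, (key q i j hi hj hij hr).elim]
  have htmem : ∀ q : Point 𝔹, q h → ∀ i, q (x.bval i) →
      Germ.mem (Germ.mk q (t i)) (Germ.mk q (x.func i)) := fun q hq i hi => by
    rw [Germ.mem_mk, ht, (extensional_bvMem_left _).point_iSup]
    simpa only [Germ.exists_iff, Germ.mem_mk] using
      hne q hq _ (Germ.mem_mk.2 (q.mono (bval_le_bvMem x i) hi))
  have hxmem : ∀ (q : Point 𝔹) i, q (x.bval i) → Germ.mem (Germ.mk q (x.func i)) (Germ.mk q x) :=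
    fun q i hi => Germ.mem_mk.2 (q.mono (bval_le_bvMem x i) hi)
  refine ⟨s, fun q hq => Germ.forall_iff.2 fun y hy => ?_⟩
  -- A point need not select an index from the supremum defining membership. Existence and
  -- uniqueness are thus proved in `𝔹`, with points entering only once indices are fixed.
  have hexists : h ⊓ bvMem y x ≤ ⨆ z, bvMem z s ⊓ bvMem z y := by
    refine mem_elim (z := y) (x := x) inf_le_right fun i => ?_
    refine iSup_elim (inf_le_right.trans (inf_le_left.trans (hleast i))) fun j =>
      le_iSup_of_le (t j) (le_of_forall_point fun q hq => ?_)
    simp only [Point.inf_iff, ← Germ.mk_eq_mk] at hq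
    obtain ⟨⟨⟨hq, -⟩, -, hyi⟩, hj, hij⟩ := hq
    have hj' : q (x.bval j) := (q.inf_iff.1 hj).1
    rw [Point.inf_iff, ← Germ.mem_mk, ← Germ.mem_mk, hyi, hij]
    exact ⟨Germ.mem_mk.2 (q.mono (bval_le_bvMem s j) hj), htmem q hq j hj'⟩
  have hunique : ∀ z w, h ⊓ bvMem y x ⊓ (bvMem z s ⊓ bvMem z y) ⊓ (bvMem w s ⊓ bvMem w y) ≤
      bvEq w z := fun z w => by
    refine mem_elim (z := z) (x := s) (inf_le_left.trans (inf_le_right.trans inf_le_left))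
      fun i => mem_elim (z := w) (x := s) (inf_le_left.trans (inf_le_right.trans inf_le_left))
        fun j => le_of_forall_point fun q hq => ?_
    simp only [Point.inf_iff, ← Germ.mk_eq_mk, ← Germ.mem_mk] at hq ⊢
    obtain ⟨⟨⟨⟨⟨hq, hy⟩, -, hzy⟩, -, hwy⟩, hi, hzi⟩, hj, hwj⟩ := hq
    change q (c i) at hi
    change q (c j) at hj
    change _ = Germ.mk q (t i) at hzi
    change _ = Germ.mk q (t j) at hwj
    have hi' : q (x.bval i) := (q.inf_iff.1 hi).1
    have hj' : q (x.bval j) := (q.inf_iff.1 hj).1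
    rw [hzi] at hzy
    rw [hwj] at hwy
    have hyi := hdisj q hq _ _ (hxmem q i hi') hy _ (htmem q hq i hi') hzy
    have hyj := hdisj q hq _ _ (hxmem q j hj') hy _ (htmem q hq j hj') hwy
    rw [hzi, hwj, hindex q i j hi hj (hyi.trans hyj.symm)]
  have hz := q.mono hexists (q.inf_iff.2 ⟨hq, Germ.mem_mk.1 hy⟩)
  rw [((extensional_bvMem_left s).inf (extensional_bvMem_left y)).point_iSup] at hz
  obtain ⟨z, hz⟩ := hz
  refine ⟨Germ.mk q z, by simpa only [Point.inf_iff, Germ.mem_mk] using hz,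
    Germ.forall_iff.2 fun w hws hwy => Germ.mk_eq_mk.2 (q.mono (hunique z w) ?_)⟩
  rw [Germ.mem_mk] at hy hws hwy
  simp only [Point.inf_iff] at hz ⊢
  exact ⟨⟨⟨hq, hy⟩, hz⟩, hws, hwy⟩

theorem Germ.realize_choice (p : Point 𝔹) : Germ p ⊨ choice := by
  -- Only the outer quantifier is opened, which leaves an implication whose hypothesis has truth
  -- value `h`.
  refine fun a => realize_imp_of_forall (fun xs h hh => ?_) (Fin.snoc default a)
  simp [Fin.snoc] at hh ⊢
  obtain ⟨s, hs⟩ := exists_choice_set (xs 0) h (fun q hq => (hh q hq).1) fun q hq => (hh q hq).2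
  exact fun q hq => ⟨Germ.mk q s, hs q hq⟩

/-! ### Zorn's lemma -/

/-- The truth value of `(x, y) ∈ r`. -/
def bvRelated (r x y : bSet 𝔹) : 𝔹 :=
  (interpretation 𝔹).value Empty.elim (relatedF (n := 3) 0 1 2) ![r, x, y]

theorem point_bvRelated {q : Point 𝔹} {r x y : bSet 𝔹} :
    q (bvRelated r x y) ↔ Germ.Related (Germ.mk q r) (Germ.mk q x) (Germ.mk q y) := by
  rw [bvRelated, ← Germ.realize_iff_value, Germ.realize_relatedF]
  rfl

/-- `r` is a partial order on `x`, and each chain in `x` has an upper bound in `x`. -/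
structure IsInductiveOrder {p : Point 𝔹} (x r : Germ p) : Prop where
  refl : ∀ a, Germ.mem a x → Germ.Related r a a
  antisymm : ∀ a b, Germ.mem a x → Germ.mem b x → Germ.Related r a b → Germ.Related r b a → a = b
  trans : ∀ a b c, Germ.mem a x → Germ.mem b x → Germ.mem c x → Germ.Related r a b →
    Germ.Related r b c → Germ.Related r a c
  bounded : ∀ c, (∀ z, Germ.mem z c → Germ.mem z x) →
    (∀ a b, Germ.mem a c → Germ.mem b c → Germ.Related r a b ∨ Germ.Related r b a) →
    ∃ b, Germ.mem b x ∧ ∀ a, Germ.mem a c → Germ.Related r a b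

/-- `C` may be too large to index a name. Below `h`, however, a member of `C` is determined by its
values of equality with the members of `x`, so one representative per such code is enough. -/
theorem exists_small_name (x : bSet 𝔹) (h : 𝔹) (C : Set (bSet 𝔹)) (hC : ∀ z ∈ C, h ≤ bvMem z x) :
    ∃ y, (∀ i, y.func i ∈ C) ∧ ∀ z ∈ C, h ≤ bvMem z y := by
  let code : bSet 𝔹 → x.type → 𝔹 := fun z i => bvEq z (x.func i)
  choose t ht htc using fun k : code '' C => k.2
  refine ⟨⟨code '' C, t, fun _ => ⊤⟩, ht, fun z hz => ?_⟩
  let k : code '' C := ⟨code z, z, hz, rfl⟩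
  refine mem_intro (x := ⟨code '' C, t, fun _ => ⊤⟩) k le_top (mem_elim (hC z hz) fun i => ?_)
  have hi : bvEq (t k) (x.func i) = bvEq z (x.func i) := congrFun (htc k) i
  have hzi : h ⊓ (x.bval i ⊓ bvEq z (x.func i)) ≤ bvEq z (x.func i) :=
    inf_le_right.trans inf_le_right
  exact bvEq.trans hzi (bvEq.symm (hzi.trans hi.ge))

/-- The external family becomes a name `y` that is a chain in every quotient containing `h`. The
bound may depend on the point; the maximum principle merges these bounds into one name. -/
theorem exists_upper_bound (x r : bSet 𝔹) (h : 𝔹)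
    (hr : ∀ q : Point 𝔹, q h → IsInductiveOrder (Germ.mk q x) (Germ.mk q r)) (C : Set (bSet 𝔹))
    (hC : ∀ z ∈ C, h ≤ bvMem z x)
    (hchain : ∀ z ∈ C, ∀ w ∈ C, h ≤ bvRelated r z w ⊔ bvRelated r w z) :
    ∃ b, h ≤ bvMem b x ∧ ∀ z ∈ C, h ≤ bvRelated r z b := by
  obtain ⟨y, hyC, hCy⟩ := exists_small_name x h C hC
  have hsub : ∀ z, h ⊓ bvMem z y ≤ bvMem z x := fun z =>
    mem_elim (z := z) (x := y) inf_le_right fun i => bvMem.congr_left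
      (bvEq.symm (inf_le_right.trans inf_le_right))
      (inf_le_left.trans (inf_le_left.trans (hC _ (hyC i))))
  have htot : ∀ z w, h ⊓ bvMem z y ⊓ bvMem w y ≤ bvRelated r z w ⊔ bvRelated r w z := fun z w => by
    refine mem_elim (z := z) (x := y) (inf_le_left.trans inf_le_right) fun i =>
      mem_elim (z := w) (x := y) (inf_le_left.trans inf_le_right) fun j =>
        le_of_forall_point fun q hq => ?_
    have hij := q.mono (hchain _ (hyC i) _ (hyC j))
    simp only [Point.inf_iff, Point.sup_iff, ← Germ.mk_eq_mk, point_bvRelated] at hq hij ⊢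
    obtain ⟨⟨⟨⟨hq, -⟩, -⟩, -, hz⟩, -, hw⟩ := hq
    rw [hz, hw]
    exact hij hq
  let G : bSet 𝔹 → bSet 𝔹 → 𝔹 := fun b z => bvMem z y ⇨ bvRelated r z b
  have hG : ∀ b, Extensional (G b) := fun b => (extensional_bvMem_left y).himp
    (.of_point (fun q z => Germ.Related (Germ.mk q r) z (Germ.mk q b)) fun _ _ => point_bvRelated)
  have hF : Extensional fun b => bvMem b x ⊓ ⨅ z, G b z := (extensional_bvMem_left x).inf
    (.iInf fun z => .himp (.of_point (fun q _ => Germ.mem (Germ.mk q z) (Germ.mk q y))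
      fun _ _ => Germ.mem_mk.symm)
      (.of_point (fun q b => Germ.Related (Germ.mk q r) (Germ.mk q z) b)
        fun _ _ => point_bvRelated))
  have hle : h ≤ ⨆ b, bvMem b x ⊓ ⨅ z, G b z := le_of_forall_point fun q hq => by
    rw [hF.point_iSup]
    simp only [Point.inf_iff, (hG _).point_iInf, G, Point.himp_iff, point_bvRelated,
      ← Germ.mem_mk]
    suffices H : ∃ b, Germ.mem b (Germ.mk q x) ∧
        ∀ a, Germ.mem a (Germ.mk q y) → Germ.Related (Germ.mk q r) a b by
      simpa only [Germ.exists_iff, Germ.forall_iff] using H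
    refine (hr q hq).bounded _ (Germ.forall_iff.2 fun z hz => ?_)
      (Germ.forall_iff.2 fun z => Germ.forall_iff.2 fun w hz hw => ?_)
    · exact Germ.mem_mk.2 (q.mono (hsub z) (q.inf_iff.2 ⟨hq, Germ.mem_mk.1 hz⟩))
    · have := q.mono (htot z w)
        (q.inf_iff.2 ⟨q.inf_iff.2 ⟨hq, Germ.mem_mk.1 hz⟩, Germ.mem_mk.1 hw⟩)
      simpa only [Point.sup_iff, point_bvRelated] using this
  obtain ⟨b, hb⟩ := hF.exists_eq_iSup
  rw [← hb] at hle
  refine ⟨b, hle.trans inf_le_left, fun z hz => ?_⟩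
  exact (le_inf (hle.trans (inf_le_right.trans (iInf_le _ z))) (hCy z hz)).trans himp_inf_le

/-- Zorn's lemma is applied to the names lying in `x` throughout `h`, preordered by being related
throughout `h`. A counterexample to maximality of `m` at one point may fail elsewhere, so it is
mixed with `m` to give a competitor comparable with `m` at all points of `h`. -/
theorem exists_maximal_name (x r : bSet 𝔹) (h : 𝔹)
    (hr : ∀ q : Point 𝔹, q h → IsInductiveOrder (Germ.mk q x) (Germ.mk q r)) :
    ∃ m, ∀ q : Point 𝔹, q h → Germ.mem (Germ.mk q m) (Germ.mk q x) ∧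
      ∀ a, Germ.mem a (Germ.mk q x) → Germ.Related (Germ.mk q r) (Germ.mk q m) a →
        a = Germ.mk q m := by
  let D := {z : bSet 𝔹 // h ≤ bvMem z x}
  have hD : ∀ (z : D) (q : Point 𝔹), q h → Germ.mem (Germ.mk q z.1) (Germ.mk q x) := fun z q hq =>
    Germ.mem_mk.2 (q.mono z.2 hq)
  let R : D → D → Prop := fun z w => h ≤ bvRelated r z.1 w.1
  have hR : ∀ z w, R z w ↔ ∀ q : Point 𝔹, q h →
      Germ.Related (Germ.mk q r) (Germ.mk q z.1) (Germ.mk q w.1) := fun z w =>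
    ⟨fun hzw q hq => point_bvRelated.1 (q.mono hzw hq),
      fun H => le_of_forall_point fun q hq => point_bvRelated.2 (H q hq)⟩
  have hrefl : ∀ z, R z z := fun z => (hR z z).2 fun q hq => (hr q hq).refl _ (hD z q hq)
  obtain ⟨m, hm⟩ := exists_maximal_of_chains_bounded (r := R) (fun C hC => by
    obtain ⟨b, hbx, hb⟩ := exists_upper_bound x r h hr (Subtype.val '' C)
      (by rintro _ ⟨z, -, rfl⟩; exact z.2)
      (by
        rintro _ ⟨z, hz, rfl⟩ _ ⟨w, hw, rfl⟩
        by_cases hzw : z = w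
        · exact hzw ▸ le_sup_of_le_left (hrefl z)
        · exact (hC hz hw hzw).elim le_sup_of_le_left le_sup_of_le_right)
    exact ⟨⟨b, hbx⟩, fun a ha => hb _ ⟨a, ha, rfl⟩⟩)
    fun {a b c} hab hbc => (hR a c).2 fun q hq => (hr q hq).trans _ _ _ (hD a q hq) (hD b q hq)
      (hD c q hq) ((hR a b).1 hab q hq) ((hR b c).1 hbc q hq)
  refine ⟨m.1, fun q hq => ⟨hD m q hq, Germ.forall_iff.2 fun z hz hmz => ?_⟩⟩
  let g : 𝔹 := bvMem z x ⊓ bvRelated r m.1 z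
  -- the mixture of `z` on `g` and of the maximal name elsewhere is a name above the latter
  obtain ⟨y, hy⟩ := exists_mixture (ι := ULift Bool) (fun i => cond i.down g gᶜ)
    (fun i => cond i.down z m.1) (by
      rintro ⟨_ | _⟩ ⟨_ | _⟩ <;> simp [bvEq_refl])
  have hyz : ∀ q : Point 𝔹, q g → Germ.mk q y = Germ.mk q z := fun q hq =>
    Germ.mk_eq_mk.2 (q.mono (hy ⟨true⟩) hq)
  have hym : ∀ q : Point 𝔹, ¬ q g → Germ.mk q y = Germ.mk q m.1 := fun q hq =>
    Germ.mk_eq_mk.2 (q.mono (hy ⟨false⟩) (q.compl_iff.2 hq))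
  have hg : ∀ q : Point 𝔹, q g ↔ Germ.mem (Germ.mk q z) (Germ.mk q x) ∧
      Germ.Related (Germ.mk q r) (Germ.mk q m.1) (Germ.mk q z) := fun q => by
    simp only [g, Point.inf_iff, Germ.mem_mk, point_bvRelated]
  have hyx : h ≤ bvMem y x := le_of_forall_point fun q hq => by
    rw [← Germ.mem_mk]
    by_cases hqg : q g
    · rw [hyz q hqg]
      exact ((hg q).1 hqg).1
    · rw [hym q hqg]
      exact hD m q hq
  have hmy : R m ⟨y, hyx⟩ := (hR _ _).2 fun q hq => by
    by_cases hqg : q g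
    · rw [hyz q hqg]
      exact ((hg q).1 hqg).2
    · rw [hym q hqg]
      exact (hr q hq).refl _ (hD m q hq)
  have hqg : q g := (hg q).2 ⟨hz, hmz⟩
  -- In a preorder, maximality only says that the competitor `y` lies below `m`; at `q` it is `z`,
  -- and antisymmetry concludes.
  have hzm := (hR _ _).1 (hm _ hmy) q hq
  rw [hyz q hqg] at hzm
  exact (hr q hq).antisymm _ _ hz (hD m q hq) hzm hmz

theorem Germ.realize_zorn (p : Point 𝔹) : Germ p ⊨ zorn := by
  refine fun a b => realize_imp_of_forall (fun xs h hh => ?_) (Fin.snoc (Fin.snoc default a) b)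
  simp [isPartialOrderF, Fin.snoc] at hh ⊢
  obtain ⟨m, hm⟩ := exists_maximal_name (xs 0) (xs 1) h fun q hq =>
    ⟨(hh q hq).1.1, (hh q hq).1.2.1, (hh q hq).1.2.2, (hh q hq).2⟩
  exact fun q hq => ⟨Germ.mk q m, hm q hq⟩

/-! ### The fundamental theorem -/

theorem Germ.realize_of_mem_ZFC (p : Point 𝔹) {φ : setLanguage.Sentence} (h : φ ∈ ZFC) :
    Germ p ⊨ φ := by
  rcases h with ((h | ⟨n, φ, rfl⟩) | ⟨n, φ, rfl⟩) | ⟨n, φ, rfl⟩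
  · rcases h with rfl | rfl | rfl | rfl | rfl | rfl | rfl | rfl
    exacts [realize_extensionality, realize_emptySet, realize_pairing, realize_union,
      realize_powerSet, realize_infinity, realize_regularity, realize_choice p]
  · exact realize_separation φ
  · exact realize_replacement φ
  · exact realize_collection φ

end BooleanValued

theorem mainTheorem3 (𝔹 : Type u) [CompleteBooleanAlgebra 𝔹] :
    (BooleanValued.bSet.interpretation 𝔹).IsModel BooleanValued.ZFC ∧
    (BooleanValued.bSet.interpretation 𝔹).truth BooleanValued.zorn = ⊤ ∧
    -- mixtures
    (∀ (ι : Type u) (a : ι → 𝔹) (τ : ι → BooleanValued.bSet 𝔹),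
      (∀ i j, a i ⊓ a j ≤ (τ i).bvEq (τ j)) →
      ∃ x : BooleanValued.bSet 𝔹, ∀ i, a i ≤ x.bvEq (τ i)) ∧
    -- the maximum principle
    (∀ (n : ℕ) (φ : BooleanValued.SetFormula (n + 1)) (p : Fin n → BooleanValued.bSet 𝔹),
      ∃ x : BooleanValued.bSet 𝔹,
        (BooleanValued.bSet.interpretation 𝔹).value Empty.elim φ (Fin.snoc p x) =
          (BooleanValued.bSet.interpretation 𝔹).value Empty.elim (∃' φ) p) :=
  ⟨⟨BooleanValued.bSet.isStructure_interpretation, fun _ hφ =>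
      BooleanValued.truth_eq_top fun p => BooleanValued.Germ.realize_of_mem_ZFC p hφ⟩,
    BooleanValued.truth_eq_top BooleanValued.Germ.realize_zorn,
    fun _ => BooleanValued.bSet.exists_mixture,
    fun _ => BooleanValued.bSet.exists_value_eq_value_ex Empty.elim⟩
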